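/- Fix a finite domain $\mathsf{DOM}\subset\mathbb Z$ with $0,1\in\mathsf{DOM}$ (for instance $\{0,1\}$ or $\{-N,\dots,N\}$ with $N\ge 1$), a countable family of Boolean-valued and a countable family of $\mathsf{DOM}$-valued functions on $\mathsf{DOM}$ of fixed arities (equality being among the former), a countable family of rational-valued scoring functions $F(\tilde d)(u,v)$, and a countable family of user-defined distributions $\mathsf{choose}(s,\tilde d)$ on $\mathsf{DOM}$ ($s>0$). The language $\mathsf{Simple}$ has variables of four types: Boolean, $\mathsf{DOM}$, integer ($\mathbb Z$) and real ($\mathbb R$). Its expressions are $B::=\mathsf{true}\mid\mathsf{false}\mid \mathsf b\mid not(B)\mid B\ and\ B\mid B\ or\ B\mid g(\tilde E)$, $\;E::=d\mid \mathsf x\mid f(\tilde E)$, $\;Z::=\mathsf z\mid iZ\mid EZ\mid Z+Z\mid Z+i\mid Z+E$ $(i\in\mathbb Z)$, $\;R::=\mathsf r\mid qR\mid ER\mid R+R\mid R+q\mid R+E$ $(q\in\mathbb Q)$. Its statements are: assignments of expressions to variables of the same type; assignments to a Boolean variable of the result of a comparison ($<,>,=,\le,\ge$) of two integer expressions, of an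 integer and a $\mathsf{DOM}$ expression, of two real expressions, or of a real and a $\mathsf{DOM}$ expression; random assignments $\mathsf r\leftarrow\mathrm{Lap}(a\epsilon,E)$ (density $\frac{a\epsilon}{2}e^{-a\epsilon|x-E|}$), $\mathsf z\leftarrow\mathrm{DLap}(a\epsilon,E)$ (mass $\frac{1-e^{-a\epsilon}}{1+e^{-a\epsilon}}e^{-a\epsilon|i-E|}$ at $i\in\mathbb Z$), $\mathsf x\leftarrow\exp(a\epsilon,F(\tilde{\mathsf x}),E)$ (mass proportional to $e^{a\epsilon F(\tilde{\mathsf x})(E,v)}$ at $v\in\mathsf{DOM}$) and $\mathsf x\leftarrow\mathsf{choose}(a\epsilon,\tilde E)$, with $a\in\mathbb Q^{>0}$; $\mathsf{if}\ B\ \mathsf{then}\ P\ \mathsf{else}\ P$; $\mathsf{while}\ B\ \mathsf{do}\ P$; and $\mathsf{exit}$. A program $P_\epsilon$ is a nonempty finite sequence of statements together with finite lists of $\mathsf{DOM}$-valued input variables and output variables; $\epsilon>0$ is a parameter. For an input $u$ (a valuation of the input variables) all other variables start at $\mathsf{false}$ or $0$, the program is run as a Markov chain on pairs (control point, memory), and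 $\mathrm{Prob}(P_\epsilon(u)\in O)$ is the probability that it reaches an $\mathsf{exit}$ statement with the valuation of the output variables in $O$. Programs are assumed to terminate (reach $\mathsf{exit}$) with probability $1$ on every input for every $\epsilon>0$, and never to use the value of a variable that has not been assigned before (input variables count as assigned). For a symmetric relation $\Phi$ on inputs, $P_\epsilon$ is $(\eta,\delta)$-differentially private w.r.t. $\Phi$ if $\mathrm{Prob}(P_\epsilon(u)\in O)\le e^{\eta}\,\mathrm{Prob}(P_\epsilon(u')\in O)+\delta$ for all $(u,u')\in\Phi$ and all sets $O$ of outputs. **Theorem.** The following problems are undecidable; that is, there is no algorithm that halts with the correct answer on every (encoded) instance of the kind described. 1. (Fixed parameter.) Given a program $P_\epsilon$, a symmetric adjacency relation $\Phi$ (an explicit list of pairs) and $\epsilon_0,\delta_0,t\in\mathbb Q^{>0}$, is $P_{\epsilon_0}$ $(t\epsilon_0,\delta_0)$-differentially private w.r.t. $\Phi$? 2. (All parameters.) Given a program $P_\epsilon$, an interval $I\subseteq(0,\infty)$ with rational (or infinite) end-points, a finitely represented function $\delta:(0,\infty)\to[0,1]$ (constants being represented by rational numbers, other functions by names from an arbitrary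 fixed collection), a symmetric adjacency relation $\Phi$ and $t\in\mathbb Q^{>0}$, is $P_\epsilon$ $(t\epsilon,\delta(\epsilon))$-differentially private w.r.t. $\Phi$ for every $\epsilon\in I$? This holds even for programs with a single input variable and a single output variable (Boolean, if $\mathsf{DOM}=\{0,1\}$), the adjacency relation $\Phi=\{(0,1),(1,0)\}$, $\delta=0$ and $t=1$: 3. for every fixed rational $\epsilon_0>0$, it is undecidable, given such a program, whether $P_{\epsilon_0}$ is $(\epsilon_0,0)$-differentially private w.r.t. $\Phi$; 4. it is undecidable, given such a program, whether $P_\epsilon$ is $(\epsilon,0)$-differentially private w.r.t. $\Phi$ for every $\epsilon>0$. -/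

import Mathlib

open MeasureTheory ProbabilityTheory
open scoped ENNReal

namespace SimpleDP

/-! ### The language -/

/-- The parameters of the language: the finite discrete domain `DOM` (a finite set of integers that
contains `0` and `1`), the families of Boolean-valued and `DOM`-valued functions on `DOM` (of fixed
arities, hence finite and computable objects; equality is among them), the rational-valued scoring
functions `F(x̃)(u, v)` for the exponential mechanism and the user-defined distributions
`choose(s, d̃)` on `DOM`. Function symbols have names that can be written down (`Encodable`).
No definability or uniformity requirement is put on the user-defined distributions, so
quantifying over all signatures covers every instance of the language. -/
structure Sig where
  dom : Finset ℤ
  zero_mem : (0 : ℤ) ∈ dom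
  one_mem : (1 : ℤ) ∈ dom
  BoolFn : Type
  boolEnc : Encodable BoolFn
  boolArity : BoolFn → ℕ
  boolFn : (g : BoolFn) → (Fin (boolArity g) → {d // d ∈ dom}) → Bool
  eqFn : BoolFn
  eq_arity : boolArity eqFn = 2
  eq_spec : ∀ v, boolFn eqFn v = true ↔ v (Fin.cast eq_arity.symm 0) = v (Fin.cast eq_arity.symm 1)
  DomFn : Type
  domEnc : Encodable DomFn
  domArity : DomFn → ℕ
  domFn : (f : DomFn) → (Fin (domArity f) → {d // d ∈ dom}) → {d // d ∈ dom}
  Score : Type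
  scoreEnc : Encodable Score
  scoreArity : Score → ℕ
  score : (F : Score) → (Fin (scoreArity F) → {d // d ∈ dom}) →
    {d // d ∈ dom} → {d // d ∈ dom} → ℚ
  Choice : Type
  choiceEnc : Encodable Choice
  choiceArity : Choice → ℕ
  choiceProb : (c : Choice) → ℝ → (Fin (choiceArity c) → {d // d ∈ dom}) → {d // d ∈ dom} → ℝ
  choice_nonneg : ∀ c s v d, 0 < s → 0 ≤ choiceProb c s v d
  choice_sum : ∀ c s v, 0 < s → ∑ d, choiceProb c s v d = 1

attribute [instance] Sig.boolEnc Sig.domEnc Sig.scoreEnc Sig.choiceEnc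

/-- The domain `DOM` as a type. -/
abbrev Sig.Dom (S : Sig) : Type := {d : ℤ // d ∈ S.dom}

def Sig.zero (S : Sig) : S.Dom := ⟨0, S.zero_mem⟩

def Sig.one (S : Sig) : S.Dom := ⟨1, S.one_mem⟩

/-- `DOM` expressions. Variables of each of the four types are numbered. -/
inductive DExpr (S : Sig) : Type
  | const (d : S.Dom)
  | var (x : ℕ)
  | app (f : S.DomFn) (args : Fin (S.domArity f) → DExpr S)

/-- Boolean expressions. -/
inductive BExpr (S : Sig) : Type
  | tt
  | ff
  | var (b : ℕ)
  | not (B : BExpr S)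
  | and (B₁ B₂ : BExpr S)
  | or (B₁ B₂ : BExpr S)
  | app (g : S.BoolFn) (args : Fin (S.boolArity g) → DExpr S)

/-- Integer expressions. -/
inductive ZExpr (S : Sig) : Type
  | var (z : ℕ)
  | smul (i : ℤ) (Z : ZExpr S)
  | dmul (E : DExpr S) (Z : ZExpr S)
  | add (Z₁ Z₂ : ZExpr S)
  | addConst (Z : ZExpr S) (i : ℤ)
  | addDom (Z : ZExpr S) (E : DExpr S)

/-- Real expressions. -/
inductive RExpr (S : Sig) : Type
  | var (r : ℕ)
  | smul (q : ℚ) (R : RExpr S)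
  | dmul (E : DExpr S) (R : RExpr S)
  | add (R₁ R₂ : RExpr S)
  | addConst (R : RExpr S) (q : ℚ)
  | addDom (R : RExpr S) (E : DExpr S)

/-- Comparison symbols. -/
inductive Cmp : Type
  | lt | gt | eq | le | ge

/-- Assignments. The number `a` is the positive rational in the scale `a ε` of a distribution. -/
inductive Cmd (S : Sig) : Type
  | assignD (x : ℕ) (E : DExpr S)
  | assignZ (z : ℕ) (Z : ZExpr S)
  | assignR (r : ℕ) (R : RExpr S)
  | assignB (b : ℕ) (B : BExpr S)
  | cmpZZ (b : ℕ) (c : Cmp) (Z₁ Z₂ : ZExpr S)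
  | cmpZE (b : ℕ) (c : Cmp) (Z : ZExpr S) (E : DExpr S)
  | cmpRR (b : ℕ) (c : Cmp) (R₁ R₂ : RExpr S)
  | cmpRE (b : ℕ) (c : Cmp) (R : RExpr S) (E : DExpr S)
  | lap (r : ℕ) (a : {q : ℚ // 0 < q}) (E : DExpr S)
  | dlap (z : ℕ) (a : {q : ℚ // 0 < q}) (E : DExpr S)
  | expMech (x : ℕ) (a : {q : ℚ // 0 < q}) (F : S.Score) (xs : Fin (S.scoreArity F) → ℕ)
      (E : DExpr S)
  | choose (x : ℕ) (a : {q : ℚ // 0 < q}) (c : S.Choice) (Es : Fin (S.choiceArity c) → DExpr S)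

mutual
/-- Statements. -/
inductive Stmt (S : Sig) : Type
  | cmd (c : Cmd S)
  | ite (B : BExpr S) (P Q : Block S)
  | while (B : BExpr S) (P : Block S)
  | exit

/-- Nonempty sequences of statements. -/
inductive Block (S : Sig) : Type
  | one (s : Stmt S)
  | cons (s : Stmt S) (P : Block S)
end

def Block.toList {S : Sig} : Block S → List (Stmt S)
  | .one s => [s]
  | .cons s P => s :: P.toList

/-- A program: input variables, output variables (`DOM` variables, listed without repetition) and
a sequence of statements. -/
structure Program (S : Sig) where
  inputs : List ℕ
  outputs : List ℕ
  body : Block S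
  inputs_nodup : inputs.Nodup
  outputs_nodup : outputs.Nodup

/-- Valuations of the input variables, as sequences of elements of `DOM`. -/
abbrev Program.Input {S : Sig} (P : Program S) : Type := Fin P.inputs.length → S.Dom

/-- Valuations of the output variables. -/
abbrev Program.Output {S : Sig} (P : Program S) : Type := Fin P.outputs.length → S.Dom

/-! ### Memories and evaluation -/

/-- Values of the Boolean, `DOM`, integer and real variables. -/
abbrev Mem (S : Sig) : Type := (ℕ → Bool) × (ℕ → S.Dom) × (ℕ → ℤ) × (ℕ → ℝ)

def Mem.setB {S : Sig} (m : Mem S) (b : ℕ) (v : Bool) : Mem S :=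
  (Function.update m.1 b v, m.2.1, m.2.2.1, m.2.2.2)

def Mem.setD {S : Sig} (m : Mem S) (x : ℕ) (v : S.Dom) : Mem S :=
  (m.1, Function.update m.2.1 x v, m.2.2.1, m.2.2.2)

def Mem.setZ {S : Sig} (m : Mem S) (z : ℕ) (v : ℤ) : Mem S :=
  (m.1, m.2.1, Function.update m.2.2.1 z v, m.2.2.2)

noncomputable def Mem.setR {S : Sig} (m : Mem S) (r : ℕ) (v : ℝ) : Mem S :=
  (m.1, m.2.1, m.2.2.1, Function.update m.2.2.2 r v)

def DExpr.eval {S : Sig} (m : Mem S) : DExpr S → S.Dom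
  | .const d => d
  | .var x => m.2.1 x
  | .app f args => S.domFn f (fun i => (args i).eval m)

def BExpr.eval {S : Sig} (m : Mem S) : BExpr S → Bool
  | .tt => true
  | .ff => false
  | .var b => m.1 b
  | .not B => !(B.eval m)
  | .and B₁ B₂ => B₁.eval m && B₂.eval m
  | .or B₁ B₂ => B₁.eval m || B₂.eval m
  | .app g args => S.boolFn g (fun i => (args i).eval m)

def ZExpr.eval {S : Sig} (m : Mem S) : ZExpr S → ℤ
  | .var z => m.2.2.1 z
  | .smul i Z => i * Z.eval m
  | .dmul E Z => (E.eval m : ℤ) * Z.eval m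
  | .add Z₁ Z₂ => Z₁.eval m + Z₂.eval m
  | .addConst Z i => Z.eval m + i
  | .addDom Z E => Z.eval m + (E.eval m : ℤ)

noncomputable def RExpr.eval {S : Sig} (m : Mem S) : RExpr S → ℝ
  | .var r => m.2.2.2 r
  | .smul q R => (q : ℝ) * R.eval m
  | .dmul E R => ((E.eval m : ℤ) : ℝ) * R.eval m
  | .add R₁ R₂ => R₁.eval m + R₂.eval m
  | .addConst R q => R.eval m + (q : ℝ)
  | .addDom R E => R.eval m + ((E.eval m : ℤ) : ℝ)

def Cmp.rel {α : Type} [LinearOrder α] : Cmp → α → α → Bool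
  | .lt, u, v => decide (u < v)
  | .gt, u, v => decide (v < u)
  | .eq, u, v => decide (u = v)
  | .le, u, v => decide (u ≤ v)
  | .ge, u, v => decide (v ≤ u)

/-! ### Distributions -/

/-- The Laplace distribution with scale parameter `1 / s` and mean `μ`. -/
noncomputable def lapMeasure (s μ : ℝ) : Measure ℝ :=
  volume.withDensity (fun x => ENNReal.ofReal (s / 2 * Real.exp (-s * |x - μ|)))

/-- The discrete Laplace distribution with scale parameter `1 / s` and mean `μ`. -/
noncomputable def dlapMeasure (s : ℝ) (μ : ℤ) : Measure ℤ :=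
  Measure.sum (fun i : ℤ => ENNReal.ofReal
    ((1 - Real.exp (-s)) / (1 + Real.exp (-s)) * Real.exp (-s * |(i : ℝ) - (μ : ℝ)|)) •
      Measure.dirac i)

/-- The measure on `DOM` with given point masses. -/
noncomputable def pmfMeasure {S : Sig} (p : S.Dom → ℝ) : Measure S.Dom :=
  Measure.sum (fun d : S.Dom => ENNReal.ofReal (p d) • Measure.dirac d)

/-- The point masses of the exponential mechanism with score `F` at scale `s`. -/
noncomputable def expProb {S : Sig} (s : ℝ) (F : S.Dom → ℚ) (v : S.Dom) : ℝ :=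
  Real.exp (s * (F v : ℝ)) / ∑ w, Real.exp (s * (F w : ℝ))

/-! ### Markov kernel semantics -/

/-- The distribution of the memory after an assignment, for the value `ε` of the parameter. -/
noncomputable def Cmd.sem {S : Sig} (ε : ℝ) (m : Mem S) : Cmd S → Measure (Mem S)
  | .assignD x E => Measure.dirac (m.setD x (E.eval m))
  | .assignZ z Z => Measure.dirac (m.setZ z (Z.eval m))
  | .assignR r R => Measure.dirac (m.setR r (R.eval m))
  | .assignB b B => Measure.dirac (m.setB b (B.eval m))
  | .cmpZZ b c Z₁ Z₂ => Measure.dirac (m.setB b (c.rel (Z₁.eval m) (Z₂.eval m)))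
  | .cmpZE b c Z E => Measure.dirac (m.setB b (c.rel (Z.eval m) (E.eval m : ℤ)))
  | .cmpRR b c R₁ R₂ => Measure.dirac (m.setB b (c.rel (R₁.eval m) (R₂.eval m)))
  | .cmpRE b c R E => Measure.dirac (m.setB b (c.rel (R.eval m) ((E.eval m : ℤ) : ℝ)))
  | .lap r a E => (lapMeasure ((a : ℚ) * ε) ((E.eval m : ℤ) : ℝ)).map (m.setR r)
  | .dlap z a E => (dlapMeasure ((a : ℚ) * ε) (E.eval m : ℤ)).map (m.setZ z)
  | .expMech x a F xs E =>
      (pmfMeasure (expProb ((a : ℚ) * ε)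
        (S.score F (fun i => m.2.1 (xs i)) (E.eval m)))).map (m.setD x)
  | .choose x a c Es =>
      (pmfMeasure (S.choiceProb c ((a : ℚ) * ε) (fun i => (Es i).eval m))).map (m.setD x)

/-- A state: the control point and the memory. A control point (label of the statement that is to be
executed next) is represented by the list of statements that remain to be executed. -/
abbrev State (S : Sig) : Type := List (Stmt S) × Mem S

instance (S : Sig) : MeasurableSpace (List (Stmt S)) := ⊤

/-- The one-step transition probabilities. An exit state is absorbing; a run that falls off the end of
the program without executing an exit statement stays there and never reaches an exit state. -/
noncomputable def step {S : Sig} (ε : ℝ) : State S → Measure (State S)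
  | ([], m) => Measure.dirac ([], m)
  | (.cmd c :: k, m) => (c.sem ε m).map (fun m' => (k, m'))
  | (.ite B P Q :: k, m) =>
      Measure.dirac (if B.eval m = true then P.toList ++ k else Q.toList ++ k, m)
  | (.while B P :: k, m) =>
      Measure.dirac (if B.eval m = true then P.toList ++ .while B P :: k else k, m)
  | (.exit :: k, m) => Measure.dirac (.exit :: k, m)

/-! ### Encoding of programs by natural numbers -/

def codeRat (q : ℚ) : ℕ := Nat.pair (Encodable.encode q.num) q.den

def DExpr.code {S : Sig} : DExpr S → ℕ
  | .const d => Nat.pair 0 (Encodable.encode (d : ℤ))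
  | .var x => Nat.pair 1 x
  | .app f args => Nat.pair 2 (Nat.pair (Encodable.encode f)
      (Encodable.encode (List.ofFn fun i => (args i).code)))

def BExpr.code {S : Sig} : BExpr S → ℕ
  | .tt => Nat.pair 0 0
  | .ff => Nat.pair 1 0
  | .var b => Nat.pair 2 b
  | .not B => Nat.pair 3 B.code
  | .and B₁ B₂ => Nat.pair 4 (Nat.pair B₁.code B₂.code)
  | .or B₁ B₂ => Nat.pair 5 (Nat.pair B₁.code B₂.code)
  | .app g args => Nat.pair 6 (Nat.pair (Encodable.encode g)
      (Encodable.encode (List.ofFn fun i => (args i).code)))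

def ZExpr.code {S : Sig} : ZExpr S → ℕ
  | .var z => Nat.pair 0 z
  | .smul i Z => Nat.pair 1 (Nat.pair (Encodable.encode i) Z.code)
  | .dmul E Z => Nat.pair 2 (Nat.pair E.code Z.code)
  | .add Z₁ Z₂ => Nat.pair 3 (Nat.pair Z₁.code Z₂.code)
  | .addConst Z i => Nat.pair 4 (Nat.pair Z.code (Encodable.encode i))
  | .addDom Z E => Nat.pair 5 (Nat.pair Z.code E.code)

def RExpr.code {S : Sig} : RExpr S → ℕ
  | .var r => Nat.pair 0 r
  | .smul q R => Nat.pair 1 (Nat.pair (codeRat q) R.code)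
  | .dmul E R => Nat.pair 2 (Nat.pair E.code R.code)
  | .add R₁ R₂ => Nat.pair 3 (Nat.pair R₁.code R₂.code)
  | .addConst R q => Nat.pair 4 (Nat.pair R.code (codeRat q))
  | .addDom R E => Nat.pair 5 (Nat.pair R.code E.code)

def Cmp.code : Cmp → ℕ
  | .lt => 0
  | .gt => 1
  | .eq => 2
  | .le => 3
  | .ge => 4

def Cmd.code {S : Sig} : Cmd S → ℕ
  | .assignD x E => Nat.pair 0 (Nat.pair x E.code)
  | .assignZ z Z => Nat.pair 1 (Nat.pair z Z.code)
  | .assignR r R => Nat.pair 2 (Nat.pair r R.code)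
  | .assignB b B => Nat.pair 3 (Nat.pair b B.code)
  | .cmpZZ b c Z₁ Z₂ => Nat.pair 4 (Nat.pair b (Nat.pair c.code (Nat.pair Z₁.code Z₂.code)))
  | .cmpZE b c Z E => Nat.pair 5 (Nat.pair b (Nat.pair c.code (Nat.pair Z.code E.code)))
  | .cmpRR b c R₁ R₂ => Nat.pair 6 (Nat.pair b (Nat.pair c.code (Nat.pair R₁.code R₂.code)))
  | .cmpRE b c R E => Nat.pair 7 (Nat.pair b (Nat.pair c.code (Nat.pair R.code E.code)))
  | .lap r a E => Nat.pair 8 (Nat.pair r (Nat.pair (codeRat a) E.code))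
  | .dlap z a E => Nat.pair 9 (Nat.pair z (Nat.pair (codeRat a) E.code))
  | .expMech x a F xs E => Nat.pair 10 (Nat.pair x (Nat.pair (codeRat a)
      (Nat.pair (Encodable.encode F) (Nat.pair (Encodable.encode (List.ofFn xs)) E.code))))
  | .choose x a c Es => Nat.pair 11 (Nat.pair x (Nat.pair (codeRat a)
      (Nat.pair (Encodable.encode c) (Encodable.encode (List.ofFn fun i => (Es i).code)))))

mutual
def Stmt.code {S : Sig} : Stmt S → ℕ
  | .cmd c => Nat.pair 0 c.code
  | .ite B P Q => Nat.pair 1 (Nat.pair B.code (Nat.pair P.code Q.code))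
  | .while B P => Nat.pair 2 (Nat.pair B.code P.code)
  | .exit => Nat.pair 3 0

def Block.code {S : Sig} : Block S → ℕ
  | .one s => Nat.pair 0 s.code
  | .cons s P => Nat.pair 1 (Nat.pair s.code P.code)
end

def Program.code {S : Sig} (P : Program S) : ℕ :=
  Nat.pair (Encodable.encode P.inputs) (Nat.pair (Encodable.encode P.outputs) P.body.code)

/-! Distinct programs have distinct codes; in particular, there are countably many control points. -/

theorem codeRat_inj {p q : ℚ} (h : codeRat p = codeRat q) : p = q := by
  simp only [codeRat, Nat.pair_eq_pair, Encodable.encode_inj] at h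
  exact Rat.ext h.1 h.2

theorem DExpr.code_inj {S : Sig} : ∀ {E E' : DExpr S}, E.code = E'.code → E = E' := by
  intro E
  induction E with
  | const d =>
    intro E' h
    cases E' <;> simp [DExpr.code, Nat.pair_eq_pair] at h
    exact congrArg _ h
  | var x =>
    intro E' h
    cases E' <;> simp [DExpr.code, Nat.pair_eq_pair] at h
    exact congrArg _ h
  | app f args ih =>
    intro E' h
    cases E' with
    | app f' args' =>
      simp only [DExpr.code, Nat.pair_eq_pair, Encodable.encode_inj, true_and] at h
      obtain ⟨rfl, h⟩ := h
      have h' := List.ofFn_injective h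
      congr 1
      funext i
      exact ih i (congrFun h' i)
    | _ => simp [DExpr.code, Nat.pair_eq_pair] at h

theorem BExpr.code_inj {S : Sig} : ∀ {E E' : BExpr S}, E.code = E'.code → E = E' := by
  intro E
  induction E with
  | app g args =>
    intro E' h
    cases E' with
    | app g' args' =>
      simp only [BExpr.code, Nat.pair_eq_pair, Encodable.encode_inj, true_and] at h
      obtain ⟨rfl, h⟩ := h
      have h' := List.ofFn_injective h
      congr 1
      funext i
      exact DExpr.code_inj (congrFun h' i)
    | _ => simp [BExpr.code, Nat.pair_eq_pair] at h
  | not B ih =>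
    intro E' h
    cases E' <;> simp [BExpr.code, Nat.pair_eq_pair] at h
    exact congrArg _ (ih h)
  | and B C ih ih' =>
    intro E' h
    cases E' <;> simp [BExpr.code, Nat.pair_eq_pair] at h
    rw [ih h.1, ih' h.2]
  | or B C ih ih' =>
    intro E' h
    cases E' <;> simp [BExpr.code, Nat.pair_eq_pair] at h
    rw [ih h.1, ih' h.2]
  | _ =>
    intro E' h
    cases E' <;> simp_all [BExpr.code, Nat.pair_eq_pair]

theorem ZExpr.code_inj {S : Sig} : ∀ {E E' : ZExpr S}, E.code = E'.code → E = E' := by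
  intro E
  induction E <;> intro E' h <;> cases E' <;>
    simp [ZExpr.code, Nat.pair_eq_pair] at h ⊢ <;> grind [DExpr.code_inj]

theorem RExpr.code_inj {S : Sig} : ∀ {E E' : RExpr S}, E.code = E'.code → E = E' := by
  intro E
  induction E <;> intro E' h <;> cases E' <;>
    simp [RExpr.code, Nat.pair_eq_pair] at h ⊢ <;> grind [DExpr.code_inj, codeRat_inj]

theorem Cmp.code_inj : ∀ {c c' : Cmp}, c.code = c'.code → c = c' := by
  intro c c' h
  cases c <;> cases c' <;> simp_all [Cmp.code]

theorem Cmd.code_inj {S : Sig} {c c' : Cmd S} (h : c.code = c'.code) : c = c' := by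
  cases c with
  | expMech x a F xs E =>
    cases c' with
    | expMech x' a' F' xs' E' =>
      simp only [Cmd.code, Nat.pair_eq_pair, Encodable.encode_inj, true_and] at h
      obtain ⟨rfl, ha, rfl, hx, hE⟩ := h
      rw [Subtype.ext (codeRat_inj ha), List.ofFn_injective hx, DExpr.code_inj hE]
    | _ => simp [Cmd.code, Nat.pair_eq_pair] at h
  | choose x a c Es =>
    cases c' with
    | choose x' a' c' Es' =>
      simp only [Cmd.code, Nat.pair_eq_pair, Encodable.encode_inj, true_and] at h
      obtain ⟨rfl, ha, rfl, hE⟩ := h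
      have hE' : Es = Es' := funext fun i => DExpr.code_inj (congrFun (List.ofFn_injective hE) i)
      rw [Subtype.ext (codeRat_inj ha), hE']
    | _ => simp [Cmd.code, Nat.pair_eq_pair] at h
  | _ =>
    cases c' <;> simp [Cmd.code, Nat.pair_eq_pair] at h ⊢ <;>
      grind [DExpr.code_inj, BExpr.code_inj, ZExpr.code_inj, RExpr.code_inj, Cmp.code_inj,
        codeRat_inj]

mutual
theorem Stmt.code_inj {S : Sig} : ∀ {s s' : Stmt S}, s.code = s'.code → s = s'
  | .cmd c, s', h => by
    cases s' <;> simp [Stmt.code, Nat.pair_eq_pair] at h ⊢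
    exact Cmd.code_inj h
  | .ite B P Q, s', h => by
    cases s' <;> simp [Stmt.code, Nat.pair_eq_pair] at h ⊢
    exact ⟨BExpr.code_inj h.1, Block.code_inj h.2.1, Block.code_inj h.2.2⟩
  | .while B P, s', h => by
    cases s' <;> simp [Stmt.code, Nat.pair_eq_pair] at h ⊢
    exact ⟨BExpr.code_inj h.1, Block.code_inj h.2⟩
  | .exit, s', h => by
    cases s' <;> simp [Stmt.code, Nat.pair_eq_pair] at h ⊢

theorem Block.code_inj {S : Sig} : ∀ {P P' : Block S}, P.code = P'.code → P = P'
  | .one s, P', h => by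
    cases P' <;> simp [Block.code, Nat.pair_eq_pair] at h ⊢
    exact Stmt.code_inj h
  | .cons s P, P', h => by
    cases P' <;> simp [Block.code, Nat.pair_eq_pair] at h ⊢
    exact ⟨Stmt.code_inj h.1, Block.code_inj h.2⟩
end

theorem Program.code_inj {S : Sig} {P P' : Program S} (h : P.code = P'.code) : P = P' := by
  cases P
  cases P'
  simp only [Program.code, Nat.pair_eq_pair, Encodable.encode_inj] at h
  obtain ⟨rfl, rfl, h⟩ := h
  have := Block.code_inj h
  subst this
  rfl

instance (S : Sig) : Countable (Stmt S) :=
  Function.Injective.countable (f := Stmt.code) fun _ _ h => Stmt.code_inj h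

/-! ### Measurability of the transition probabilities -/

theorem DExpr.measurable_eval {S : Sig} (E : DExpr S) : Measurable (fun m : Mem S => E.eval m) := by
  induction E with
  | const d => exact measurable_const
  | var x => exact (measurable_pi_apply x).comp (measurable_fst.comp measurable_snd)
  | app f args ih =>
    exact (Measurable.of_discrete (f := S.domFn f)).comp (measurable_pi_lambda _ ih)

theorem BExpr.measurable_eval {S : Sig} (B : BExpr S) : Measurable (fun m : Mem S => B.eval m) := by
  induction B with
  | tt => exact measurable_const
  | ff => exact measurable_const
  | var b => exact (measurable_pi_apply b).comp measurable_fst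
  | not B ih => exact (Measurable.of_discrete (f := Bool.not)).comp ih
  | and B C ihB ihC =>
    exact (Measurable.of_discrete (f := fun p : Bool × Bool => p.1 && p.2)).comp (ihB.prodMk ihC)
  | or B C ihB ihC =>
    exact (Measurable.of_discrete (f := fun p : Bool × Bool => p.1 || p.2)).comp (ihB.prodMk ihC)
  | app g args =>
    exact (Measurable.of_discrete (f := S.boolFn g)).comp
      (measurable_pi_lambda _ fun i => (args i).measurable_eval)

theorem DExpr.measurable_eval_int {S : Sig} (E : DExpr S) :
    Measurable (fun m : Mem S => (E.eval m : ℤ)) :=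
  measurable_subtype_coe.comp E.measurable_eval

theorem DExpr.measurable_eval_real {S : Sig} (E : DExpr S) :
    Measurable (fun m : Mem S => ((E.eval m : ℤ) : ℝ)) :=
  (Measurable.of_discrete (f := fun i : ℤ => (i : ℝ))).comp E.measurable_eval_int

theorem ZExpr.measurable_eval {S : Sig} (Z : ZExpr S) : Measurable (fun m : Mem S => Z.eval m) := by
  induction Z with
  | var z =>
    exact (measurable_pi_apply z).comp (measurable_fst.comp (measurable_snd.comp measurable_snd))
  | smul i Z ih => exact ih.const_mul i
  | dmul E Z ih => exact E.measurable_eval_int.mul ih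
  | add Z₁ Z₂ ih₁ ih₂ => exact ih₁.add ih₂
  | addConst Z i ih => exact ih.add_const i
  | addDom Z E ih => exact ih.add E.measurable_eval_int

theorem RExpr.measurable_eval {S : Sig} (R : RExpr S) : Measurable (fun m : Mem S => R.eval m) := by
  induction R with
  | var r =>
    exact (measurable_pi_apply r).comp (measurable_snd.comp (measurable_snd.comp measurable_snd))
  | smul q R ih => exact ih.const_mul _
  | dmul E R ih => exact E.measurable_eval_real.mul ih
  | add R₁ R₂ ih₁ ih₂ => exact ih₁.add ih₂
  | addConst R q ih => exact ih.add_const _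
  | addDom R E ih => exact ih.add E.measurable_eval_real

theorem Cmp.measurable_rel_int {S : Sig} (c : Cmp) {f g : Mem S → ℤ} (hf : Measurable f)
    (hg : Measurable g) : Measurable (fun m => c.rel (f m) (g m)) :=
  (Measurable.of_discrete (f := fun p : ℤ × ℤ => c.rel p.1 p.2)).comp (hf.prodMk hg)

theorem Cmp.measurable_rel_real {S : Sig} (c : Cmp) {f g : Mem S → ℝ} (hf : Measurable f)
    (hg : Measurable g) : Measurable (fun m => c.rel (f m) (g m)) := by
  cases c with
  | lt => exact measurable_to_bool (by simpa [Cmp.rel, Set.preimage] using measurableSet_lt hf hg)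
  | gt => exact measurable_to_bool (by simpa [Cmp.rel, Set.preimage] using measurableSet_lt hg hf)
  | eq => exact measurable_to_bool (by simpa [Cmp.rel, Set.preimage] using measurableSet_eq_fun hf hg)
  | le => exact measurable_to_bool (by simpa [Cmp.rel, Set.preimage] using measurableSet_le hf hg)
  | ge => exact measurable_to_bool (by simpa [Cmp.rel, Set.preimage] using measurableSet_le hg hf)

theorem measurable_update_pair {α β : Type} [MeasurableSpace α] [MeasurableSpace β]
    {f : α → ℕ → β} {g : α → β} (n : ℕ) (hf : Measurable f) (hg : Measurable g) :
    Measurable (fun a => Function.update (f a) n (g a)) := by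
  refine measurable_pi_lambda _ fun i => ?_
  by_cases h : i = n
  · subst h
    simpa using hg
  · simp only [Function.update_of_ne h]
    exact (measurable_pi_apply i).comp hf

theorem Mem.measurable_setB {S : Sig} (b : ℕ) :
    Measurable (fun p : Mem S × Bool => p.1.setB b p.2) := by
  refine Measurable.prodMk (measurable_update_pair b ?_ ?_) ?_ <;> fun_prop

theorem Mem.measurable_setD {S : Sig} (x : ℕ) :
    Measurable (fun p : Mem S × S.Dom => p.1.setD x p.2) := by
  refine Measurable.prodMk ?_ (Measurable.prodMk (measurable_update_pair x ?_ ?_) ?_) <;> fun_prop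

theorem Mem.measurable_setZ {S : Sig} (z : ℕ) :
    Measurable (fun p : Mem S × ℤ => p.1.setZ z p.2) := by
  refine Measurable.prodMk ?_ (Measurable.prodMk ?_
    (Measurable.prodMk (measurable_update_pair z ?_ ?_) ?_)) <;> fun_prop

theorem Mem.measurable_setR {S : Sig} (r : ℕ) :
    Measurable (fun p : Mem S × ℝ => p.1.setR r p.2) := by
  refine Measurable.prodMk ?_ (Measurable.prodMk ?_
    (Measurable.prodMk ?_ (measurable_update_pair r ?_ ?_))) <;> fun_prop

theorem measurable_dirac_comp {α β γ : Type} [MeasurableSpace α] [MeasurableSpace β]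
    [MeasurableSpace γ] {u : α → β → γ} (hu : Measurable (Function.uncurry u)) {e : α → β}
    (he : Measurable e) : Measurable (fun a => Measure.dirac (u a (e a))) :=
  Measure.measurable_dirac.comp (hu.comp (measurable_id.prodMk he))

theorem measurable_map_comp {α β γ δ : Type} [MeasurableSpace α] [MeasurableSpace β]
    [MeasurableSpace γ] [MeasurableSpace δ] [Countable δ] [DiscreteMeasurableSpace δ]
    {u : α → β → γ} (hu : Measurable (Function.uncurry u)) {e : α → δ} (he : Measurable e)
    (μ : δ → Measure β) [∀ d, SFinite (μ d)] : Measurable (fun a => (μ (e a)).map (u a)) := by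
  have key : Measurable (fun p : δ × α => (μ p.1).map (u p.2)) := by
    refine measurable_from_prod_countable_right fun d => ?_
    refine Measure.measurable_of_measurable_coe _ fun A hA => ?_
    have h : ∀ a, ((μ d).map (u a)) A = (μ d) (Prod.mk a ⁻¹' (Function.uncurry u ⁻¹' A)) := fun a =>
      Measure.map_apply (hu.comp measurable_prodMk_left) hA
    simp only [h]
    exact measurable_measure_prodMk_left (hu hA)
  exact key.comp (he.prodMk measurable_id)

theorem Cmd.measurable_sem {S : Sig} (ε : ℝ) (c : Cmd S) :
    Measurable (fun m : Mem S => c.sem ε m) := by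
  cases c with
  | assignD x E => exact measurable_dirac_comp (Mem.measurable_setD x) E.measurable_eval
  | assignZ z Z => exact measurable_dirac_comp (Mem.measurable_setZ z) Z.measurable_eval
  | assignR r R => exact measurable_dirac_comp (Mem.measurable_setR r) R.measurable_eval
  | assignB b B => exact measurable_dirac_comp (Mem.measurable_setB b) B.measurable_eval
  | cmpZZ b c Z₁ Z₂ =>
    exact measurable_dirac_comp (Mem.measurable_setB b)
      (c.measurable_rel_int Z₁.measurable_eval Z₂.measurable_eval)
  | cmpZE b c Z E =>
    exact measurable_dirac_comp (Mem.measurable_setB b)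
      (c.measurable_rel_int Z.measurable_eval E.measurable_eval_int)
  | cmpRR b c R₁ R₂ =>
    exact measurable_dirac_comp (Mem.measurable_setB b)
      (c.measurable_rel_real R₁.measurable_eval R₂.measurable_eval)
  | cmpRE b c R E =>
    exact measurable_dirac_comp (Mem.measurable_setB b)
      (c.measurable_rel_real R.measurable_eval E.measurable_eval_real)
  | lap r a E =>
    have (d : S.Dom) : SFinite (lapMeasure ((a : ℚ) * ε) ((d : ℤ) : ℝ)) := by
      unfold lapMeasure; infer_instance
    exact measurable_map_comp (Mem.measurable_setR r) E.measurable_eval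
      (fun d : S.Dom => lapMeasure ((a : ℚ) * ε) ((d : ℤ) : ℝ))
  | dlap z a E =>
    have (d : S.Dom) : SFinite (dlapMeasure ((a : ℚ) * ε) (d : ℤ)) := by
      unfold dlapMeasure; infer_instance
    exact measurable_map_comp (Mem.measurable_setZ z) E.measurable_eval
      (fun d : S.Dom => dlapMeasure ((a : ℚ) * ε) (d : ℤ))
  | expMech x a F xs E =>
    have (p : S.Dom → ℝ) : SFinite (pmfMeasure p) := by
      unfold pmfMeasure; infer_instance
    exact measurable_map_comp (Mem.measurable_setD x)
      (Measurable.prodMk (measurable_pi_lambda (fun (m : Mem S) i => m.2.1 (xs i))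
        fun i => (DExpr.var (xs i)).measurable_eval) E.measurable_eval)
      (fun d : (Fin (S.scoreArity F) → S.Dom) × S.Dom =>
        pmfMeasure (expProb ((a : ℚ) * ε) (S.score F d.1 d.2)))
  | choose x a c Es =>
    have (p : S.Dom → ℝ) : SFinite (pmfMeasure p) := by
      unfold pmfMeasure; infer_instance
    exact measurable_map_comp (Mem.measurable_setD x)
      (measurable_pi_lambda (fun (m : Mem S) i => (Es i).eval m) fun i => (Es i).measurable_eval)
      (fun d => pmfMeasure (S.choiceProb c ((a : ℚ) * ε) d))

theorem measurable_step {S : Sig} (ε : ℝ) : Measurable (step ε : State S → Measure (State S)) := by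
  have hk : ∀ k : List (Stmt S), Measurable (fun m : Mem S => (k, m)) :=
    fun k => measurable_prodMk_left
  have hite : ∀ (B : BExpr S) (k k' : List (Stmt S)),
      Measurable fun m : Mem S => Measure.dirac (if B.eval m = true then k else k', m) := by
    intro B k k'
    refine Measure.measurable_dirac.comp (Measurable.prodMk (Measurable.ite ?_ ?_ ?_) measurable_id)
    · exact B.measurable_eval (measurableSet_singleton true)
    · exact measurable_const
    · exact measurable_const
  refine measurable_from_prod_countable_right fun k => ?_
  match k with
  | [] => exact Measure.measurable_dirac.comp (hk [])
  | .cmd c :: k => exact (Measure.measurable_map _ (hk k)).comp (c.measurable_sem ε)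
  | .ite B P Q :: k => exact hite B _ _
  | .while B P :: k => exact hite B _ _
  | .exit :: k => exact Measure.measurable_dirac.comp (hk (.exit :: k))

/-- The Markov kernel of the language, for the value `ε` of the parameter. -/
noncomputable def kernel {S : Sig} (ε : ℝ) : Kernel (State S) (State S) := ⟨step ε, measurable_step ε⟩

/-! ### Output probabilities, termination and differential privacy -/

/-- Exit states: the next statement is `exit`. -/
def State.IsExit {S : Sig} (s : State S) : Prop := s.1.head? = some Stmt.exit

open Classical in
/-- The probability that the execution from a state reaches an exit state for the first time after
exactly `n` steps, with a memory in `T` there. -/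
noncomputable def exitProb {S : Sig} (ε : ℝ) (T : Set (Mem S)) : ℕ → State S → ℝ≥0∞
  | 0, s => if State.IsExit s ∧ s.2 ∈ T then 1 else 0
  | n + 1, s => if State.IsExit s then 0 else ∫⁻ s', exitProb ε T n s' ∂(kernel ε s)

/-- The initial memory: input variables get the given values, all others `false` or `0`. -/
noncomputable def Program.initMem {S : Sig} (P : Program S) (u : P.Input) : Mem S :=
  (fun _ => false,
   fun x => if h : P.inputs.idxOf x < P.inputs.length then u ⟨P.inputs.idxOf x, h⟩ else S.zero,
   fun _ => 0, fun _ => 0)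

/-- The values of the output variables. -/
def Program.output {S : Sig} (P : Program S) (m : Mem S) : P.Output := fun i => m.2.1 (P.outputs.get i)

/-- `Prob(P_ε(u) ∈ O)`: the probability that on input `u` the program exits with an output in `O`. -/
noncomputable def Program.prob {S : Sig} (P : Program S) (ε : ℝ) (u : P.Input) (O : Set P.Output) :
    ℝ≥0∞ :=
  ∑' n, exitProb ε {m | P.output m ∈ O} n (P.body.toList, P.initMem u)

/-- The program terminates with probability `1` on every input, for every `ε > 0`. -/
def Program.Terminates {S : Sig} (P : Program S) : Prop :=
  ∀ ε : ℝ, 0 < ε → ∀ u, P.prob ε u Set.univ = 1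

/-- `P_ε` is `(η, δ)`-differentially private with respect to the adjacency relation `Φ`. -/
def Program.DP {S : Sig} (P : Program S) (ε η δ : ℝ) (Φ : List (P.Input × P.Input)) : Prop :=
  ∀ O : Set P.Output, ∀ u u' : P.Input, (u, u') ∈ Φ →
    P.prob ε u O ≤ ENNReal.ofReal (Real.exp η) * P.prob ε u' O + ENNReal.ofReal δ

/-! ### Variables are assigned before they are used -/

inductive Var : Type
  | bool (n : ℕ)
  | dom (n : ℕ)
  | int (n : ℕ)
  | real (n : ℕ)

def DExpr.vars {S : Sig} : DExpr S → Set Var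
  | .const _ => ∅
  | .var x => {.dom x}
  | .app _ args => ⋃ i, (args i).vars

def BExpr.vars {S : Sig} : BExpr S → Set Var
  | .tt => ∅
  | .ff => ∅
  | .var b => {.bool b}
  | .not B => B.vars
  | .and B₁ B₂ => B₁.vars ∪ B₂.vars
  | .or B₁ B₂ => B₁.vars ∪ B₂.vars
  | .app _ args => ⋃ i, (args i).vars

def ZExpr.vars {S : Sig} : ZExpr S → Set Var
  | .var z => {.int z}
  | .smul _ Z => Z.vars
  | .dmul E Z => E.vars ∪ Z.vars
  | .add Z₁ Z₂ => Z₁.vars ∪ Z₂.vars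
  | .addConst Z _ => Z.vars
  | .addDom Z E => Z.vars ∪ E.vars

def RExpr.vars {S : Sig} : RExpr S → Set Var
  | .var r => {.real r}
  | .smul _ R => R.vars
  | .dmul E R => E.vars ∪ R.vars
  | .add R₁ R₂ => R₁.vars ∪ R₂.vars
  | .addConst R _ => R.vars
  | .addDom R E => R.vars ∪ E.vars

/-- The variables on the right-hand side of an assignment. -/
def Cmd.reads {S : Sig} : Cmd S → Set Var
  | .assignD _ E => E.vars
  | .assignZ _ Z => Z.vars
  | .assignR _ R => R.vars
  | .assignB _ B => B.vars
  | .cmpZZ _ _ Z₁ Z₂ => Z₁.vars ∪ Z₂.vars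
  | .cmpZE _ _ Z E => Z.vars ∪ E.vars
  | .cmpRR _ _ R₁ R₂ => R₁.vars ∪ R₂.vars
  | .cmpRE _ _ R E => R.vars ∪ E.vars
  | .lap _ _ E => E.vars
  | .dlap _ _ E => E.vars
  | .expMech _ _ _ xs E => Set.range (fun i => Var.dom (xs i)) ∪ E.vars
  | .choose _ _ _ Es => ⋃ i, (Es i).vars

/-- The variable on the left-hand side of an assignment. -/
def Cmd.target {S : Sig} : Cmd S → Var
  | .assignD x _ => .dom x
  | .assignZ z _ => .int z
  | .assignR r _ => .real r
  | .assignB b _ => .bool b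
  | .cmpZZ b _ _ _ => .bool b
  | .cmpZE b _ _ _ => .bool b
  | .cmpRR b _ _ _ => .bool b
  | .cmpRE b _ _ _ => .bool b
  | .lap r _ _ => .real r
  | .dlap z _ _ => .int z
  | .expMech x _ _ _ _ => .dom x
  | .choose x _ _ _ => .dom x

/-- The possible memories after an assignment; a sampled variable may get any value of its type. -/
def Cmd.post {S : Sig} (m : Mem S) : Cmd S → Set (Mem S)
  | .assignD x E => {m.setD x (E.eval m)}
  | .assignZ z Z => {m.setZ z (Z.eval m)}
  | .assignR r R => {m.setR r (R.eval m)}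
  | .assignB b B => {m.setB b (B.eval m)}
  | .cmpZZ b c Z₁ Z₂ => {m.setB b (c.rel (Z₁.eval m) (Z₂.eval m))}
  | .cmpZE b c Z E => {m.setB b (c.rel (Z.eval m) (E.eval m : ℤ))}
  | .cmpRR b c R₁ R₂ => {m.setB b (c.rel (R₁.eval m) (R₂.eval m))}
  | .cmpRE b c R E => {m.setB b (c.rel (R.eval m) ((E.eval m : ℤ) : ℝ))}
  | .lap r _ _ => Set.range (m.setR r)
  | .dlap z _ _ => Set.range (m.setZ z)
  | .expMech x _ _ _ _ => Set.range (m.setD x)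
  | .choose x _ _ _ => Set.range (m.setD x)

/-- The variables whose values a statement uses in its own step. -/
def Stmt.reads {S : Sig} : Stmt S → Set Var
  | .cmd c => c.reads
  | .ite B _ _ => B.vars
  | .while B _ => B.vars
  | .exit => ∅

/-- `P.Reach k m A`: some execution of `P` arrives at the control point `k` with memory `m`, and the
variables assigned so far (including the input variables) are those in `A`. -/
inductive Program.Reach {S : Sig} (P : Program S) : List (Stmt S) → Mem S → Set Var → Prop
  | init (u : P.Input) : P.Reach P.body.toList (P.initMem u) {v | ∃ x ∈ P.inputs, v = .dom x}
  | cmd {c : Cmd S} {k : List (Stmt S)} {m m' : Mem S} {A : Set Var} :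
      P.Reach (.cmd c :: k) m A → m' ∈ c.post m → P.Reach k m' (insert c.target A)
  | ite {B : BExpr S} {P₁ P₂ : Block S} {k : List (Stmt S)} {m : Mem S} {A : Set Var} :
      P.Reach (.ite B P₁ P₂ :: k) m A →
      P.Reach (if B.eval m = true then P₁.toList ++ k else P₂.toList ++ k) m A
  | while {B : BExpr S} {P₁ : Block S} {k : List (Stmt S)} {m : Mem S} {A : Set Var} :
      P.Reach (.while B P₁ :: k) m A →
      P.Reach (if B.eval m = true then P₁.toList ++ .while B P₁ :: k else k) m A

/-- In every execution, a variable has been assigned a value before its value is used. -/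
def Program.AssignedBeforeUse {S : Sig} (P : Program S) : Prop :=
  ∀ s k m A, P.Reach (s :: k) m A → s.reads ⊆ A

/-- The standing assumptions on programs. -/
def Program.Admissible {S : Sig} (P : Program S) : Prop := P.Terminates ∧ P.AssignedBeforeUse

/-! ### The decision problems -/

/-- The problem `Q`, for instances in the class `D` that are given by their codes, is decidable: some
algorithm halts with the correct answer on every instance in `D` (and may do anything, including
running forever, on other inputs). -/
def DecidableOn {α : Type} (code : α → ℕ) (D : Set α) (Q : α → Prop) : Prop :=
  ∃ f : ℕ →. Bool, Partrec f ∧ ∀ a ∈ D, ∃ b ∈ f (code a), (b = true ↔ Q a)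

def codeAdj {S : Sig} {P : Program S} (Φ : List (P.Input × P.Input)) : ℕ :=
  Encodable.encode (Φ.map fun p =>
    (List.ofFn fun i => (p.1 i : ℤ), List.ofFn fun i => (p.2 i : ℤ)))

/-- An adjacency relation is symmetric. -/
def SymmetricList {α : Type} (Φ : List (α × α)) : Prop := ∀ u u', (u, u') ∈ Φ → (u', u) ∈ Φ

/-- Instances of the fixed-parameter problem. -/
structure FixedInstance (S : Sig) where
  prog : Program S
  adj : List (prog.Input × prog.Input)
  ε₀ : ℚ
  δ₀ : ℚ
  t : ℚ

def FixedInstance.code {S : Sig} (I : FixedInstance S) : ℕ :=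
  Nat.pair I.prog.code (Nat.pair (codeAdj I.adj)
    (Nat.pair (codeRat I.ε₀) (Nat.pair (codeRat I.δ₀) (codeRat I.t))))

/-- `ε₀`, `δ₀` and `t` are positive rationals, the adjacency relation is symmetric and the program
satisfies the standing assumptions. -/
def FixedInstance.Valid {S : Sig} (I : FixedInstance S) : Prop :=
  I.prog.Admissible ∧ SymmetricList I.adj ∧ 0 < I.ε₀ ∧ 0 < I.δ₀ ∧ 0 < I.t

/-- `P_{ε₀}` is `(t ε₀, δ₀)`-differentially private. -/
def FixedInstance.Private {S : Sig} (I : FixedInstance S) : Prop :=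
  I.prog.DP (I.ε₀ : ℝ) ((I.t : ℝ) * (I.ε₀ : ℝ)) (I.δ₀ : ℝ) I.adj

/-- A finite representation of error functions `δ(ε)`: constants are represented by rational numbers,
and other functions by names from any chosen collection. -/
structure ErrorNames where
  Name : Type
  enc : Encodable Name
  val : Name → ℝ → ℝ

attribute [instance] ErrorNames.enc

inductive ErrorFn (Θ : ErrorNames) : Type
  | const (q : ℚ)
  | named (n : Θ.Name)

def ErrorFn.val {Θ : ErrorNames} : ErrorFn Θ → ℝ → ℝ
  | .const q, _ => (q : ℝ)
  | .named n, ε => Θ.val n ε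

def ErrorFn.code {Θ : ErrorNames} : ErrorFn Θ → ℕ
  | .const q => Nat.pair 0 (codeRat q)
  | .named n => Nat.pair 1 (Encodable.encode n)

/-- Intervals with rational end-points; `none` as upper end-point means `∞`. -/
structure RatInterval where
  lo : ℚ
  hi : Option ℚ
  loClosed : Bool
  hiClosed : Bool

def RatInterval.toSet (J : RatInterval) : Set ℝ :=
  {x | (if J.loClosed = true then (J.lo : ℝ) ≤ x else (J.lo : ℝ) < x) ∧
    ∀ h ∈ J.hi, if J.hiClosed = true then x ≤ (h : ℝ) else x < (h : ℝ)}

def RatInterval.code (J : RatInterval) : ℕ :=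
  Nat.pair (codeRat J.lo) (Nat.pair (Encodable.encode (J.hi.map codeRat))
    (Nat.pair (Encodable.encode J.loClosed) (Encodable.encode J.hiClosed)))

/-- Instances of the problem for all values of the parameter in an interval. -/
structure UniformInstance (S : Sig) (Θ : ErrorNames) where
  prog : Program S
  interval : RatInterval
  δ : ErrorFn Θ
  adj : List (prog.Input × prog.Input)
  t : ℚ

def UniformInstance.code {S : Sig} {Θ : ErrorNames} (I : UniformInstance S Θ) : ℕ :=
  Nat.pair I.prog.code (Nat.pair I.interval.code (Nat.pair I.δ.code
    (Nat.pair (codeAdj I.adj) (codeRat I.t))))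

/-- The interval consists of positive reals, `δ` maps positive reals to `[0, 1]`, `t` is positive, the
adjacency relation is symmetric and the program satisfies the standing assumptions. -/
def UniformInstance.Valid {S : Sig} {Θ : ErrorNames} (I : UniformInstance S Θ) : Prop :=
  I.prog.Admissible ∧ I.interval.toSet ⊆ Set.Ioi 0 ∧ (∀ ε : ℝ, 0 < ε → I.δ.val ε ∈ Set.Icc 0 1) ∧
    SymmetricList I.adj ∧ 0 < I.t

/-- `P_ε` is `(t ε, δ(ε))`-differentially private for every `ε` in the interval. -/
def UniformInstance.Private {S : Sig} {Θ : ErrorNames} (I : UniformInstance S Θ) : Prop :=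
  ∀ ε ∈ I.interval.toSet, I.prog.DP ε ((I.t : ℝ) * ε) (I.δ.val ε) I.adj

/-- Admissible programs with a single input variable and a single output variable. -/
def oneInOneOut (S : Sig) : Set (Program S) :=
  {P | P.Admissible ∧ P.inputs.length = 1 ∧ P.outputs.length = 1}

/-- The adjacency relation `{(0, 1), (1, 0)}` (on the inputs of a program with one input variable). -/
def flipAdj {S : Sig} (P : Program S) : List (P.Input × P.Input) :=
  [(fun _ => S.zero, fun _ => S.one), (fun _ => S.one, fun _ => S.zero)]

end SimpleDP

/-!
The complement of the halting problem is reduced to each of the four privacy problems. Given a number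
`n`, which codes a program of `Nat.Partrec.Code`, the reduction builds a program that samples an
integer `g` from a discrete Laplace distribution, computes `haltsWithin n g`, and outputs its input
`x` if this number is nonzero and `0` otherwise. Every `g` has positive probability, so if the coded
program halts, then the output `1` has positive probability on the input `1` and probability `0` on the
input `0`, which contradicts `(ε, 0)`-privacy; if it does not halt, then the output is always `0`. As
the guess bounds the running time in advance, the computation that follows is deterministic and always
terminates: `haltsWithin` is primitive recursive, and primitive recursive functions are
compiled to nested loops on integer variables (`compiles_of_primrec`). The only part of the program
that depends on `n` is the constant in one assignment, so the code of the program is computable from `n`.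

With a positive error `δ`, a small probability of revealing the input is allowed, and the probability
of a successful guess has no positive lower bound that is uniform in `n`. Therefore the program is put
on the boundary of privacy: it also reveals its input if a fair coin, the sign of a
Laplace variable, shows heads. The probability of the output `1` on the input `1` is then exactly
`1 / 2` if the coded program does not halt, and larger otherwise; this decides
`(ε, 1 / 2)`-privacy (`dp_iff_of_prob`).

Output probabilities are computed with `exitTotal`, which satisfies the one-step equation
`exitTotal_step` and does not change along deterministic steps (`Leads.exitTotal_eq`).
-/

namespace SimpleDP

variable {S : Sig}

/-! ### Exit probabilities -/

theorem measurableSet_isExit : MeasurableSet {s : State S | State.IsExit s} :=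
  measurable_fst
    (MeasurableSpace.measurableSet_top (s := {k : List (Stmt S) | k.head? = some Stmt.exit}))

theorem measurable_exitProb (ε : ℝ) {T : Set (Mem S)} (hT : MeasurableSet T) (n : ℕ) :
    Measurable (exitProb ε T n : State S → ℝ≥0∞) := by
  induction n with
  | zero =>
    exact Measurable.ite (measurableSet_isExit.inter (measurable_snd hT)) measurable_const
      measurable_const
  | succ n ih =>
    exact Measurable.ite measurableSet_isExit measurable_const ih.lintegral_kernel

/-- The probability of reaching, from a given state, an exit state whose memory is in `T`. -/
noncomputable def exitTotal (ε : ℝ) (T : Set (Mem S)) (s : State S) : ℝ≥0∞ :=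
  ∑' n, exitProb ε T n s

theorem measurable_exitTotal (ε : ℝ) {T : Set (Mem S)} (hT : MeasurableSet T) :
    Measurable (exitTotal ε T : State S → ℝ≥0∞) :=
  Measurable.tsum fun n => measurable_exitProb ε hT n

theorem exitTotal_exit (ε : ℝ) (T : Set (Mem S)) (k : List (Stmt S)) (m : Mem S) :
    exitTotal ε T (.exit :: k, m) = T.indicator 1 m := by
  have h : State.IsExit ((.exit :: k, m) : State S) := rfl
  rw [exitTotal, tsum_eq_single 0]
  · by_cases hm : m ∈ T <;> simp [exitProb, h, hm]
  · intro n hn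
    obtain ⟨n, rfl⟩ := Nat.exists_eq_succ_of_ne_zero hn
    simp [exitProb, h]

/-- The Chapman–Kolmogorov equation for the first step. -/
theorem exitTotal_step (ε : ℝ) {T : Set (Mem S)} (hT : MeasurableSet T) {s : State S}
    (hs : ¬ State.IsExit s) : exitTotal ε T s = ∫⁻ s', exitTotal ε T s' ∂(step ε s) := by
  have h : ∀ n, exitProb ε T (n + 1) s = ∫⁻ s', exitProb ε T n s' ∂(step ε s) := fun n => by
    rw [exitProb, if_neg hs]; rfl
  simp only [exitTotal]
  rw [tsum_eq_zero_add' ENNReal.summable, lintegral_tsum]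
  · simp only [h]
    simp [exitProb, hs]
  · exact fun n => (measurable_exitProb ε hT n).aemeasurable

theorem exitTotal_cmd (ε : ℝ) {T : Set (Mem S)} (hT : MeasurableSet T) (c : Cmd S)
    (k : List (Stmt S)) (m : Mem S) :
    exitTotal ε T (.cmd c :: k, m) = ∫⁻ m', exitTotal ε T (k, m') ∂(c.sem ε m) := by
  rw [exitTotal_step ε hT (by simp [State.IsExit])]
  exact lintegral_map (measurable_exitTotal ε hT) measurable_prodMk_left

theorem exitTotal_dlap (ε : ℝ) {T : Set (Mem S)} (hT : MeasurableSet T) (z : ℕ)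
    (a : {q : ℚ // 0 < q}) (E : DExpr S) (k : List (Stmt S)) (m : Mem S) :
    exitTotal ε T (.cmd (.dlap z a E) :: k, m) =
      ∫⁻ i, exitTotal ε T (k, m.setZ z i) ∂(dlapMeasure ((a : ℚ) * ε) (E.eval m : ℤ)) := by
  rw [exitTotal_cmd ε hT]
  exact lintegral_map ((measurable_exitTotal ε hT).comp measurable_prodMk_left)
    ((Mem.measurable_setZ z).comp measurable_prodMk_left)

theorem exitTotal_lap (ε : ℝ) {T : Set (Mem S)} (hT : MeasurableSet T) (r : ℕ)
    (a : {q : ℚ // 0 < q}) (E : DExpr S) (k : List (Stmt S)) (m : Mem S) :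
    exitTotal ε T (.cmd (.lap r a E) :: k, m) =
      ∫⁻ x, exitTotal ε T (k, m.setR r x) ∂(lapMeasure ((a : ℚ) * ε) ((E.eval m : ℤ) : ℝ)) := by
  rw [exitTotal_cmd ε hT]
  exact lintegral_map ((measurable_exitTotal ε hT).comp measurable_prodMk_left)
    ((Mem.measurable_setR r).comp measurable_prodMk_left)

/-! ### Deterministic steps -/

/-- A step that leads to a certain state with probability one, whatever the parameter is. -/
def DetStep (s s' : State S) : Prop := ¬ State.IsExit s ∧ ∀ ε, step ε s = Measure.dirac s'

/-- Finitely many deterministic steps. -/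
def Leads : State S → State S → Prop := Relation.ReflTransGen DetStep

theorem Leads.exitTotal_eq {s s' : State S} (h : Leads s s') (ε : ℝ) {T : Set (Mem S)}
    (hT : MeasurableSet T) : exitTotal ε T s = exitTotal ε T s' := by
  induction h using Relation.ReflTransGen.head_induction_on with
  | refl => rfl
  | head h _ ih =>
    rw [exitTotal_step ε hT h.1, h.2, lintegral_dirac' _ (measurable_exitTotal ε hT), ih]

theorem Leads.cmd {c : Cmd S} {k : List (Stmt S)} {m m' : Mem S} {s : State S}
    (hc : ∀ ε, c.sem ε m = Measure.dirac m') (h : Leads (k, m') s) :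
    Leads (.cmd c :: k, m) s := by
  refine Relation.ReflTransGen.head ⟨by simp [State.IsExit], fun ε => ?_⟩ h
  rw [step, hc, Measure.map_dirac' measurable_prodMk_left]

theorem Leads.ite {B : BExpr S} {P Q : Block S} {k : List (Stmt S)} {m : Mem S} {s : State S}
    (h : Leads (if B.eval m = true then P.toList ++ k else Q.toList ++ k, m) s) :
    Leads (.ite B P Q :: k, m) s :=
  Relation.ReflTransGen.head ⟨by simp [State.IsExit], fun _ => rfl⟩ h

theorem Leads.while_true {B : BExpr S} {P : Block S} {k : List (Stmt S)} {m : Mem S} {s : State S}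
    (hB : B.eval m = true) (h : Leads (P.toList ++ .while B P :: k, m) s) :
    Leads (.while B P :: k, m) s :=
  Relation.ReflTransGen.head ⟨by simp [State.IsExit], fun _ => by simp [step, hB]⟩ h

theorem Leads.while_false {B : BExpr S} {P : Block S} {k : List (Stmt S)} {m : Mem S} {s : State S}
    (hB : B.eval m = false) (h : Leads (k, m) s) : Leads (.while B P :: k, m) s :=
  Relation.ReflTransGen.head ⟨by simp [State.IsExit], fun _ => by simp [step, hB]⟩ h

/-! ### Blocks and the variables that they read -/

/-- The block consisting of the statements in a list and one final statement. -/
def Block.ofList (l : List (Stmt S)) (s : Stmt S) : Block S := l.foldr .cons (.one s)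

@[simp] theorem Block.toList_ofList (l : List (Stmt S)) (s : Stmt S) :
    (Block.ofList l s).toList = l ++ [s] := by
  induction l with
  | nil => rfl
  | cons t l ih => exact congrArg (t :: ·) ih

mutual
/-- The variables read anywhere inside a statement. -/
def Stmt.allReads : Stmt S → Set Var
  | .cmd c => c.reads
  | .ite B P Q => B.vars ∪ (P.allReads ∪ Q.allReads)
  | .while B P => B.vars ∪ P.allReads
  | .exit => ∅

/-- The variables read anywhere inside a block. -/
def Block.allReads : Block S → Set Var
  | .one s => s.allReads
  | .cons s P => s.allReads ∪ P.allReads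
end

theorem Block.allReads_subset_iff {A : Set Var} : ∀ P : Block S,
    P.allReads ⊆ A ↔ ∀ s ∈ P.toList, s.allReads ⊆ A
  | .one s => by simp [Block.allReads, Block.toList]
  | .cons s P => by simp [Block.allReads, Block.toList, Block.allReads_subset_iff P]

theorem Stmt.reads_subset_allReads (s : Stmt S) : s.reads ⊆ s.allReads := by
  cases s <;> simp [Stmt.reads, Stmt.allReads]

/-- Each assignment in the list reads only variables in `A` and targets of earlier assignments. -/
def ReadsAssigned : Set Var → List (Cmd S) → Prop
  | _, [] => True
  | A, c :: cs => c.reads ⊆ A ∧ ReadsAssigned (insert c.target A) cs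

theorem readsAssigned_append {A : Set Var} {l l' : List (Cmd S)} :
    ReadsAssigned A (l ++ l') ↔
      ReadsAssigned A l ∧ ReadsAssigned (A ∪ {v | v ∈ l.map Cmd.target}) l' := by
  induction l generalizing A with
  | nil => simp [ReadsAssigned]
  | cons c l ih =>
    have : insert c.target A ∪ {v | v ∈ l.map Cmd.target} =
        A ∪ {v | v ∈ (c :: l).map Cmd.target} := by
      ext v
      simp only [List.map_cons, List.mem_cons, Set.mem_union, Set.mem_insert_iff,
        Set.mem_ofPred_eq]
      tauto
    simp only [List.cons_append, ReadsAssigned, ih, this, and_assoc]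

/-- If a program starts with a straight line of assignments that read only input variables and
variables assigned earlier on that line, and the rest of the program reads only input variables
and variables assigned on that line, then variables are assigned before use. -/
theorem Program.assignedBeforeUse_of_straightLine (P : Program S) (cs : List (Cmd S))
    (rest : List (Stmt S)) (hP : P.body.toList = cs.map .cmd ++ rest)
    (hcs : ReadsAssigned {v | ∃ x ∈ P.inputs, v = .dom x} cs)
    (hrest : ∀ s ∈ rest,
      s.allReads ⊆ {v | ∃ x ∈ P.inputs, v = .dom x} ∪ {v | v ∈ cs.map Cmd.target}) :
    P.AssignedBeforeUse := by
  have inv : ∀ k m A, P.Reach k m A → ∃ cs' rest', k = cs'.map .cmd ++ rest' ∧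
      ReadsAssigned A cs' ∧ ∀ s ∈ rest', s.allReads ⊆ A ∪ {v | v ∈ cs'.map Cmd.target} := by
    intro k m A h
    induction h with
    | init u => exact ⟨cs, rest, hP, hcs, hrest⟩
    | @cmd c k m m' A _ _ ih =>
      obtain ⟨cs', rest', hk, h₁, h₂⟩ := ih
      cases cs' with
      | nil =>
        simp only [List.map_nil, List.nil_append] at hk
        subst hk
        refine ⟨[], k, rfl, trivial, fun s hs => (h₂ s (List.mem_cons_of_mem _ hs)).trans ?_⟩
        exact Set.union_subset_union_left _ (Set.subset_insert _ _)
      | cons c' cs' =>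
        simp only [List.map_cons, List.cons_append, List.cons.injEq, Stmt.cmd.injEq] at hk
        obtain ⟨rfl, rfl⟩ := hk
        refine ⟨cs', rest', rfl, h₁.2, fun s hs => (h₂ s hs).trans ?_⟩
        intro v hv
        simp only [List.map_cons, List.mem_cons, Set.mem_union, Set.mem_insert_iff,
          Set.mem_ofPred_eq] at hv ⊢
        tauto
    | @ite B P₁ P₂ k m A _ ih =>
      obtain ⟨cs', rest', hk, h₁, h₂⟩ := ih
      cases cs' with
      | cons c' cs' => simp at hk
      | nil =>
        simp only [List.map_nil, List.nil_append] at hk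
        subst hk
        have h := h₂ _ List.mem_cons_self
        simp only [Stmt.allReads, Set.union_subset_iff, Block.allReads_subset_iff] at h
        refine ⟨[], _, (List.nil_append _).symm, trivial, fun s hs => ?_⟩
        split at hs <;> rcases List.mem_append.1 hs with hs | hs
        · exact h.2.1 s hs
        · exact h₂ s (List.mem_cons_of_mem _ hs)
        · exact h.2.2 s hs
        · exact h₂ s (List.mem_cons_of_mem _ hs)
    | _ =>
      -- The remaining case is that of a loop.
      rename_i B P₁ k m A _ ih
      obtain ⟨cs', rest', hk, h₁, h₂⟩ := ih
      cases cs' with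
      | cons c' cs' => simp at hk
      | nil =>
        simp only [List.map_nil, List.nil_append] at hk
        subst hk
        have h := h₂ _ List.mem_cons_self
        simp only [Stmt.allReads, Set.union_subset_iff, Block.allReads_subset_iff] at h
        refine ⟨[], _, (List.nil_append _).symm, trivial, fun s hs => ?_⟩
        split at hs
        · rcases List.mem_append.1 hs with hs | hs
          · exact h.2 s hs
          · exact h₂ s hs
        · exact h₂ s (List.mem_cons_of_mem _ hs)
  intro s k m A h
  obtain ⟨cs', rest', hk, h₁, h₂⟩ := inv _ _ _ h
  cases cs' with
  | nil =>
    simp only [List.map_nil, List.nil_append] at hk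
    subst hk
    simpa using s.reads_subset_allReads.trans (h₂ s List.mem_cons_self)
  | cons c cs' =>
    simp only [List.map_cons, List.cons_append, List.cons.injEq] at hk
    rw [hk.1]
    exact h₁.1

/-! ### Compilation of primitive recursive functions -/

@[simp] theorem Mem.setB_bool (m : Mem S) (b : ℕ) (v : Bool) :
    (m.setB b v).1 = Function.update m.1 b v := rfl

@[simp] theorem Mem.setB_dom (m : Mem S) (b : ℕ) (v : Bool) : (m.setB b v).2.1 = m.2.1 := rfl

@[simp] theorem Mem.setB_int (m : Mem S) (b : ℕ) (v : Bool) : (m.setB b v).2.2.1 = m.2.2.1 := rfl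

@[simp] theorem Mem.setZ_bool (m : Mem S) (z : ℕ) (v : ℤ) : (m.setZ z v).1 = m.1 := rfl

@[simp] theorem Mem.setZ_dom (m : Mem S) (z : ℕ) (v : ℤ) : (m.setZ z v).2.1 = m.2.1 := rfl

@[simp] theorem Mem.setZ_int (m : Mem S) (z : ℕ) (v : ℤ) :
    (m.setZ z v).2.2.1 = Function.update m.2.2.1 z v := rfl

/-- The variables that a compiled function may read: the Boolean variable `0`, which controls all
loops, and the integer variables below `N`. -/
def workVars (N : ℕ) : Set Var := {v | v = .bool 0 ∨ ∃ j < N, v = .int j}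

theorem bool_mem_workVars (N : ℕ) : Var.bool 0 ∈ workVars N := Or.inl rfl

theorem int_mem_workVars {j N : ℕ} (h : j < N) : Var.int j ∈ workVars N := Or.inr ⟨j, h, rfl⟩

theorem workVars_mono {M N : ℕ} (h : M ≤ N) : workVars M ⊆ workVars N := by
  rintro v (hv | ⟨j, hj, hv⟩)
  · exact Or.inl hv
  · exact Or.inr ⟨j, hj.trans_le h, hv⟩

/-- `Preserves p m m'`: the integer variables satisfying `p`, all Boolean variables except the
variable `0` and all `DOM` variables have the same values in `m'` as in `m`. -/
def Preserves (p : ℕ → Prop) (m m' : Mem S) : Prop :=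
  (∀ j, p j → m'.2.2.1 j = m.2.2.1 j) ∧ (∀ j, j ≠ 0 → m'.1 j = m.1 j) ∧ m'.2.1 = m.2.1

theorem Preserves.refl (p : ℕ → Prop) (m : Mem S) : Preserves p m m :=
  ⟨fun _ _ => rfl, fun _ _ => rfl, rfl⟩

theorem Preserves.trans {p : ℕ → Prop} {m m' m'' : Mem S} (h : Preserves p m m')
    (h' : Preserves p m' m'') : Preserves p m m'' :=
  ⟨fun j hj => (h'.1 j hj).trans (h.1 j hj), fun j hj => (h'.2.1 j hj).trans (h.2.1 j hj),
    h'.2.2.trans h.2.2⟩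

theorem Preserves.mono {p q : ℕ → Prop} {m m' : Mem S} (h : Preserves p m m')
    (hq : ∀ j, q j → p j) : Preserves q m m' :=
  ⟨fun j hj => h.1 j (hq j hj), h.2⟩

theorem Preserves.setZ {p : ℕ → Prop} {m : Mem S} {z : ℕ} {v : ℤ} (hz : ¬ p z) :
    Preserves p m (m.setZ z v) := by
  refine ⟨fun j hj => ?_, fun _ _ => rfl, rfl⟩
  rw [Mem.setZ_int, Function.update_of_ne]
  rintro rfl
  exact hz hj

theorem Preserves.setB {p : ℕ → Prop} {m : Mem S} {v : Bool} : Preserves p m (m.setB 0 v) :=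
  ⟨fun _ _ => rfl, fun j hj => by rw [Mem.setB_bool, Function.update_of_ne hj], rfl⟩

/-- The function `f` can be compiled: for all choices of input registers and of an output register
below `base` there are statements that compute `f` deterministically, and that modify no
register below `base` other than the output register. -/
def Compiles (S : Sig) {n : ℕ} (f : List.Vector ℕ n → ℕ) : Prop :=
  ∀ (ins : Fin n → ℕ) (out base : ℕ), (∀ i, ins i < base) → out < base →
    ∃ (L : List (Stmt S)) (N : ℕ), (∀ s ∈ L, s.allReads ⊆ workVars N) ∧
      ∀ (k : List (Stmt S)) (m : Mem S) (v : List.Vector ℕ n),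
        (∀ i, m.2.2.1 (ins i) = v.get i) →
        ∃ m', Leads (L ++ k, m) (k, m') ∧ m'.2.2.1 out = f v ∧
          Preserves (fun j => j < base ∧ j ≠ out) m m'

theorem compiles_zero : Compiles S (n := 0) fun _ => 0 := by
  intro ins out base _ hout
  -- There are no integer literals: the constant `0` is written as `0 * out`.
  refine ⟨[.cmd (.assignZ out (.smul 0 (.var out)))], base, ?_, ?_⟩
  · simpa [Stmt.allReads, Cmd.reads, ZExpr.vars] using int_mem_workVars hout
  · intro k m v _
    refine ⟨_, Leads.cmd (fun _ => rfl) .refl, ?_, .setZ (by simp)⟩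
    simp [ZExpr.eval]

theorem compiles_succ : Compiles S (n := 1) fun v => v.head.succ := by
  intro ins out base hins _
  refine ⟨[.cmd (.assignZ out (.addConst (.var (ins 0)) 1))], base, ?_, ?_⟩
  · simpa [Stmt.allReads, Cmd.reads, ZExpr.vars] using int_mem_workVars (hins 0)
  · intro k m v hv
    refine ⟨_, Leads.cmd (fun _ => rfl) .refl, ?_, .setZ (by simp)⟩
    simp [ZExpr.eval, hv]

theorem compiles_get {n : ℕ} (i : Fin n) : Compiles S fun v => v.get i := by
  intro ins out base hins _
  refine ⟨[.cmd (.assignZ out (.var (ins i)))], base, ?_, ?_⟩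
  · simpa [Stmt.allReads, Cmd.reads, ZExpr.vars] using int_mem_workVars (hins i)
  · intro k m v hv
    refine ⟨_, Leads.cmd (fun _ => rfl) .refl, ?_, .setZ (by simp)⟩
    simp [ZExpr.eval, hv]

/-- The first `j` inner functions of a composition are evaluated into the registers
`base, …, base + j - 1`. -/
theorem exists_compiled_tuple {l n : ℕ} {g : Fin n → List.Vector ℕ l → ℕ}
    (hg : ∀ i, Compiles S (g i)) (ins : Fin l → ℕ) (base : ℕ) (hins : ∀ i, ins i < base) (j : ℕ)
    (hj : j ≤ n) :
    ∃ (L : List (Stmt S)) (N : ℕ), (∀ s ∈ L, s.allReads ⊆ workVars N) ∧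
      ∀ (k : List (Stmt S)) (m : Mem S) (v : List.Vector ℕ l),
        (∀ i, m.2.2.1 (ins i) = v.get i) →
        ∃ m', Leads (L ++ k, m) (k, m') ∧ (∀ i : Fin n, i < j → m'.2.2.1 (base + i) = g i v) ∧
          Preserves (fun j => j < base) m m' := by
  induction j with
  | zero => exact ⟨[], 0, by simp, fun k m v _ => ⟨m, .refl, by simp, .refl _ _⟩⟩
  | succ j ih =>
    obtain ⟨L₁, N₁, hL₁, h₁⟩ := ih (by omega)
    obtain ⟨L₂, N₂, hL₂, h₂⟩ := hg ⟨j, hj⟩ ins (base + j) (base + n)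
      (fun i => (hins i).trans_le (by omega)) (by omega)
    refine ⟨L₁ ++ L₂, max N₁ N₂, fun s hs => ?_, fun k m v hv => ?_⟩
    · rcases List.mem_append.1 hs with hs | hs
      · exact (hL₁ s hs).trans (workVars_mono (le_max_left _ _))
      · exact (hL₂ s hs).trans (workVars_mono (le_max_right _ _))
    · obtain ⟨m₁, hm₁, hr₁, hp₁⟩ := h₁ (L₂ ++ k) m v hv
      obtain ⟨m₂, hm₂, hr₂, hp₂⟩ := h₂ k m₁ v fun i => (hp₁.1 _ (hins i)).trans (hv i)
      refine ⟨m₂, by rw [List.append_assoc]; exact hm₁.trans hm₂, fun i hi => ?_,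
        hp₁.trans (hp₂.mono fun i hi => ?_)⟩
      · rcases Nat.lt_succ_iff_lt_or_eq.1 hi with hi | hi
        · rw [hp₂.1 _ ⟨by omega, by omega⟩, hr₁ i hi]
        · have : i = ⟨j, hj⟩ := Fin.ext hi
          subst this
          exact hr₂
      · exact ⟨Nat.lt_add_right _ hi, by omega⟩

theorem compiles_comp {l n : ℕ} {f : List.Vector ℕ n → ℕ} {g : Fin n → List.Vector ℕ l → ℕ}
    (hf : Compiles S f) (hg : ∀ i, Compiles S (g i)) :
    Compiles S fun v => f (List.Vector.ofFn fun i => g i v) := by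
  intro ins out base hins hout
  obtain ⟨L₁, N₁, hL₁, h₁⟩ := exists_compiled_tuple hg ins base hins n le_rfl
  obtain ⟨L₂, N₂, hL₂, h₂⟩ := hf (fun i => base + i) out (base + n) (fun i => by simp) (by omega)
  refine ⟨L₁ ++ L₂, max N₁ N₂, fun s hs => ?_, fun k m v hv => ?_⟩
  · rcases List.mem_append.1 hs with hs | hs
    · exact (hL₁ s hs).trans (workVars_mono (le_max_left _ _))
    · exact (hL₂ s hs).trans (workVars_mono (le_max_right _ _))
  · obtain ⟨m₁, hm₁, hr₁, hp₁⟩ := h₁ (L₂ ++ k) m v hv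
    obtain ⟨m₂, hm₂, hr₂, hp₂⟩ := h₂ k m₁ (List.Vector.ofFn fun i => g i v) fun i => by
      rw [List.Vector.get_ofFn]
      exact hr₁ i i.2
    exact ⟨m₂, by rw [List.append_assoc]; exact hm₁.trans hm₂, hr₂,
      (hp₁.mono fun i hi => hi.1).trans (hp₂.mono fun i hi => ⟨Nat.lt_add_right _ hi.1, hi.2⟩)⟩

/-- The loop of a primitive recursion: `count` runs up to the value of `bound`, and `acc` holds the
values of the recursion. -/
def recLoop (count bound : ℕ) (body : List (Stmt S)) : Stmt S :=
  .while (.var 0) (Block.ofList (body ++ [.cmd (.assignZ count (.addConst (.var count) 1))])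
    (.cmd (.cmpZZ 0 .lt (.var count) (.var bound))))

/-- The recursion loop computes `F a` if its body computes `F (y + 1)` from `y` and `F y`. The counter is
the register `base`, the accumulator is `base + 1`, and `good` is an invariant that depends only on
registers below `base`. -/
theorem leads_recLoop {bound base : ℕ} (hbound : bound < base) {body : List (Stmt S)}
    {a : ℕ} {F : ℕ → ℕ} {good : Mem S → Prop}
    (hgood : ∀ m m', good m → Preserves (· < base) m m' → good m')
    (hbound_good : ∀ m, good m → m.2.2.1 bound = a)
    (hbody : ∀ (k : List (Stmt S)) (m : Mem S) (y : ℕ), good m → m.2.2.1 base = y →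
      m.2.2.1 (base + 1) = F y → ∃ m', Leads (body ++ k, m) (k, m') ∧
        m'.2.2.1 (base + 1) = F (y + 1) ∧
        Preserves (fun j => j < base + 2 ∧ j ≠ base + 1) m m')
    (k : List (Stmt S)) (d : ℕ) : ∀ (m : Mem S) (y : ℕ), good m → y + d = a →
      m.2.2.1 base = y → m.2.2.1 (base + 1) = F y → m.1 0 = decide (y < a) →
      ∃ m', Leads (recLoop base bound body :: k, m) (k, m') ∧ m'.2.2.1 (base + 1) = F a ∧
        Preserves (· < base) m m' := by
  induction d with
  | zero =>
    intro m y _ hy _ hacc hb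
    obtain rfl : y = a := hy
    exact ⟨m, Leads.while_false (by simpa [BExpr.eval] using hb) .refl, hacc, .refl _ _⟩
  | succ d ih =>
    intro m y hm hy hc hacc hb
    obtain ⟨m₁, hm₁, hr₁, hp₁⟩ := hbody
      ([.cmd (.assignZ base (.addConst (.var base) 1)),
        .cmd (.cmpZZ 0 .lt (.var base) (.var bound))] ++ recLoop base bound body :: k) m y hm hc hacc
    have hpb : Preserves (· < base) m m₁ := hp₁.mono fun j hj => ⟨by omega, by omega⟩
    have hp : Preserves (· < base) m
        ((m₁.setZ base (y + 1 : ℕ)).setB 0 (decide (y + 1 < a))) :=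
      (hpb.trans (.setZ (lt_irrefl base))).trans .setB
    obtain ⟨m₂, hm₂, hr₂, hp₂⟩ := ih ((m₁.setZ base (y + 1 : ℕ)).setB 0 (decide (y + 1 < a)))
      (y + 1) (hgood _ _ hm hp) (by omega) (by simp) (by simpa using hr₁) (by simp)
    refine ⟨m₂, Leads.while_true (by simp only [BExpr.eval, hb]; simp; omega) ?_, hr₂, hp.trans hp₂⟩
    rw [Block.toList_ofList, List.append_assoc, List.append_assoc]
    refine hm₁.trans (Leads.cmd (m' := m₁.setZ base (y + 1 : ℕ)) (fun ε => ?_)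
      (Leads.cmd (fun ε => ?_) hm₂))
    · have hc₁ : m₁.2.2.1 base = y := (hp₁.1 base ⟨by omega, by omega⟩).trans hc
      simp only [Cmd.sem, ZExpr.eval, hc₁]
      norm_cast
    · have ha₁ : m₁.2.2.1 bound = a := hbound_good _ (hgood _ _ hm hpb)
      have hne : bound ≠ base := hbound.ne
      simp only [Cmd.sem, ZExpr.eval, Mem.setZ_int, Function.update_self,
        Function.update_of_ne hne, ha₁, Cmp.rel, Nat.cast_lt]

theorem compiles_prec {n : ℕ} {f : List.Vector ℕ n → ℕ} {g : List.Vector ℕ (n + 2) → ℕ}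
    (hf : Compiles S f) (hg : Compiles S g) :
    Compiles S fun v : List.Vector ℕ (n + 1) =>
      v.head.rec (f v.tail) fun y IH => g (y ::ᵥ IH ::ᵥ v.tail) := by
  intro ins out base hins hout
  obtain ⟨L₁, N₁, hL₁, h₁⟩ := hf (fun i => ins i.succ) (base + 1) (base + 2)
    (fun i => (hins _).trans_le (by omega)) (by omega)
  obtain ⟨L₂, N₂, hL₂, h₂⟩ := hg (Fin.cons base (Fin.cons (base + 1) fun i => ins i.succ))
    (base + 1) (base + 2)
    (fun i => by
      refine Fin.cases (by simp) (fun i => ?_) i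
      refine Fin.cases (by simp) (fun i => ?_) i
      simpa using (hins _).trans_le (by omega)) (by omega)
  have hb₁ : base < max (base + 2) (max N₁ N₂) := by omega
  have hb₂ : base + 1 < max (base + 2) (max N₁ N₂) := by omega
  have hb₃ : ins 0 < max (base + 2) (max N₁ N₂) := by have := hins 0; omega
  have hN₁ := workVars_mono (show N₁ ≤ max (base + 2) (max N₁ N₂) by omega)
  have hN₂ := workVars_mono (show N₂ ≤ max (base + 2) (max N₁ N₂) by omega)
  refine ⟨L₁ ++ [.cmd (.assignZ base (.smul 0 (.var base))),
    .cmd (.cmpZZ 0 .lt (.var base) (.var (ins 0))), recLoop base (ins 0) L₂,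
    .cmd (.assignZ out (.var (base + 1)))], max (base + 2) (max N₁ N₂), fun s hs => ?_,
    fun k m v hv => ?_⟩
  · simp only [List.mem_append, List.mem_cons, List.not_mem_nil, or_false] at hs
    rcases hs with hs | rfl | rfl | rfl | rfl
    · exact (hL₁ s hs).trans hN₁
    · simpa [Stmt.allReads, Cmd.reads, ZExpr.vars] using int_mem_workVars hb₁
    · simpa [Stmt.allReads, Cmd.reads, ZExpr.vars, Set.insert_subset_iff] using
        ⟨int_mem_workVars hb₃, int_mem_workVars hb₁⟩
    · simp only [recLoop, Stmt.allReads, Set.union_subset_iff, Block.allReads_subset_iff,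
        Block.toList_ofList, List.mem_append, List.mem_singleton]
      refine ⟨by simpa [BExpr.vars] using bool_mem_workVars _, ?_⟩
      rintro s ((hs | rfl) | rfl)
      · exact (hL₂ s hs).trans hN₂
      · simpa [Stmt.allReads, Cmd.reads, ZExpr.vars] using int_mem_workVars hb₁
      · simpa [Stmt.allReads, Cmd.reads, ZExpr.vars, Set.insert_subset_iff] using
          ⟨int_mem_workVars hb₃, int_mem_workVars hb₁⟩
    · simpa [Stmt.allReads, Cmd.reads, ZExpr.vars] using int_mem_workVars hb₂
  · have hhead : m.2.2.1 (ins 0) = v.head := by rw [hv 0, List.Vector.get_zero]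
    have htail : ∀ i : Fin n, m.2.2.1 (ins i.succ) = v.tail.get i := fun i => by
      rw [hv, List.Vector.get_tail_succ]
    obtain ⟨m₁, hm₁, hr₁, hp₁⟩ := h₁ ([.cmd (.assignZ base (.smul 0 (.var base))),
      .cmd (.cmpZZ 0 .lt (.var base) (.var (ins 0))), recLoop base (ins 0) L₂,
      .cmd (.assignZ out (.var (base + 1)))] ++ k) m v.tail htail
    have hp₂ : Preserves (· < base) m
        ((m₁.setZ base (0 : ℕ)).setB 0 (decide (0 < v.head))) :=
      ((hp₁.mono (q := (· < base)) fun j (hj : j < base) => ⟨by omega, by omega⟩).trans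
        (.setZ (lt_irrefl base))).trans .setB
    obtain ⟨m₃, hm₃, hr₃, hp₃⟩ := leads_recLoop (hins 0) (body := L₂) (a := v.head)
      (F := fun y => y.rec (f v.tail) fun y IH => g (y ::ᵥ IH ::ᵥ v.tail))
      (good := Preserves (· < base) m) (fun _ _ h h' => h.trans h')
      (fun m' h => (h.1 _ (hins 0)).trans hhead)
      (fun k m' y hm' hc hacc => by
        refine h₂ k m' (y ::ᵥ (y.rec (f v.tail) fun y IH => g (y ::ᵥ IH ::ᵥ v.tail)) ::ᵥ v.tail)
          fun i => ?_
        refine Fin.cases (by simpa using hc) (fun i => ?_) i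
        refine Fin.cases hacc (fun i => ?_) i
        simpa using (hm'.1 _ (hins _)).trans (htail i))
      (.cmd (.assignZ out (.var (base + 1))) :: k) v.head _ 0 hp₂ (by simp) (by simp)
      (by simpa using hr₁) (by simp)
    refine ⟨m₃.setZ out (m₃.2.2.1 (base + 1)), ?_, by simpa using hr₃, ?_⟩
    · rw [List.append_assoc]
      refine hm₁.trans (Leads.cmd (m' := m₁.setZ base (0 : ℕ)) (fun ε => ?_)
        (Leads.cmd (fun ε => ?_) (hm₃.trans (Leads.cmd (fun ε => rfl) .refl))))
      · simp only [Cmd.sem, ZExpr.eval, zero_mul, Nat.cast_zero]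
      · have ha₁ : m₁.2.2.1 (ins 0) = v.head :=
          (hp₁.1 _ ⟨by have := hins 0; omega, by have := hins 0; omega⟩).trans hhead
        have hne : ins 0 ≠ base := (hins 0).ne
        simp only [Cmd.sem, ZExpr.eval, Mem.setZ_int, Function.update_self,
          Function.update_of_ne hne, ha₁, Cmp.rel, Nat.cast_lt]
    · exact ((hp₂.trans hp₃).mono fun j hj => hj.1).trans (.setZ (by simp))

/-- Every primitive recursive function is computed by a terminating deterministic program fragment. -/
theorem compiles_of_primrec {n : ℕ} {f : List.Vector ℕ n → ℕ} (hf : Nat.Primrec' f) :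
    Compiles S f := by
  induction hf with
  | zero => exact compiles_zero
  | succ => exact compiles_succ
  | get i => exact compiles_get i
  | comp g _ _ hf hg => exact compiles_comp hf hg
  | prec _ _ hf hg => exact compiles_prec hf hg

/-! ### The Laplace distributions -/

theorem lintegral_dlapMeasure (s : ℝ) (μ : ℤ) (f : ℤ → ℝ≥0∞) :
    ∫⁻ i, f i ∂(dlapMeasure s μ) = ∑' i : ℤ, ENNReal.ofReal ((1 - Real.exp (-s)) /
      (1 + Real.exp (-s)) * Real.exp (-s * |(i : ℝ) - (μ : ℝ)|)) * f i := by
  simp [dlapMeasure, lintegral_sum_measure]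

theorem hasSum_dlap {s : ℝ} (hs : 0 < s) :
    HasSum (fun i : ℤ => (1 - Real.exp (-s)) / (1 + Real.exp (-s)) *
      Real.exp (-s * |(i : ℝ) - ((0 : ℤ) : ℝ)|)) 1 := by
  have hq₀ : 0 < Real.exp (-s) := Real.exp_pos _
  have hq₁ : Real.exp (-s) < 1 := Real.exp_zero ▸ Real.exp_lt_exp.2 (by linarith)
  have hpow : ∀ n : ℕ, Real.exp (-s * n) = Real.exp (-s) ^ n := fun n => by
    rw [← Real.exp_nat_mul]; ring_nf
  have hgeo := hasSum_geometric_of_lt_one hq₀.le hq₁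
  have h : HasSum (fun i : ℤ => Real.exp (-s * |(i : ℝ) - ((0 : ℤ) : ℝ)|))
      ((1 - Real.exp (-s))⁻¹ + Real.exp (-s) * (1 - Real.exp (-s))⁻¹) := by
    refine HasSum.of_nat_of_neg_add_one ?_ ?_
    · refine hgeo.congr_fun fun n => ?_
      simp [← hpow]
    · refine (hgeo.mul_left _).congr_fun fun n => ?_
      rw [← pow_succ', ← hpow]
      congr 2
      push_cast
      rw [sub_zero, abs_neg, abs_of_nonneg (by positivity)]
  have h' := h.mul_left ((1 - Real.exp (-s)) / (1 + Real.exp (-s)))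
  have h₁ : 1 - Real.exp (-s) ≠ 0 := by linarith
  have h₂ : 1 + Real.exp (-s) ≠ 0 := by linarith
  rwa [show (1 - Real.exp (-s)) / (1 + Real.exp (-s)) *
    ((1 - Real.exp (-s))⁻¹ + Real.exp (-s) * (1 - Real.exp (-s))⁻¹) = 1 by field_simp] at h'

theorem dlapMeasure_univ {s : ℝ} (hs : 0 < s) : dlapMeasure s 0 Set.univ = 1 := by
  have hq₁ : Real.exp (-s) < 1 := Real.exp_zero ▸ Real.exp_lt_exp.2 (by linarith)
  rw [← lintegral_one, lintegral_dlapMeasure]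
  simp only [mul_one]
  rw [← ENNReal.ofReal_tsum_of_nonneg (fun i => ?_) (hasSum_dlap hs).summable,
    (hasSum_dlap hs).tsum_eq, ENNReal.ofReal_one]
  have : 0 ≤ 1 - Real.exp (-s) := by linarith
  positivity

theorem lapMeasure_Ioi {s : ℝ} (hs : 0 < s) : lapMeasure s 0 (Set.Ioi 0) = 2⁻¹ := by
  rw [lapMeasure, withDensity_apply _ measurableSet_Ioi,
    setLIntegral_congr_fun (g := fun x => ENNReal.ofReal (s / 2 * Real.exp (-s * x)))
      measurableSet_Ioi (fun x (hx : 0 < x) => by simp [abs_of_pos hx]),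
    ← ofReal_integral_eq_lintegral_ofReal
      ((integrableOn_exp_mul_Ioi (neg_lt_zero.2 hs) 0).const_mul _)
      (ae_of_all _ fun x => by positivity),
    integral_const_mul, integral_exp_mul_Ioi (neg_lt_zero.2 hs)]
  rw [show s / 2 * (-Real.exp (-s * 0) / -s) = 2⁻¹ by simp; field_simp,
    ENNReal.ofReal_inv_of_pos two_pos, ENNReal.ofReal_ofNat]

theorem lapMeasure_Iic {s : ℝ} (hs : 0 < s) : lapMeasure s 0 (Set.Iic 0) = 2⁻¹ := by
  rw [lapMeasure, withDensity_apply _ measurableSet_Iic,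
    setLIntegral_congr_fun (g := fun x => ENNReal.ofReal (s / 2 * Real.exp (s * x)))
      measurableSet_Iic (fun x (hx : x ≤ 0) => by simp [abs_of_nonpos hx]),
    ← ofReal_integral_eq_lintegral_ofReal
      ((integrableOn_exp_mul_Iic hs 0).const_mul _)
      (ae_of_all _ fun x => by positivity),
    integral_const_mul, integral_exp_mul_Iic hs]
  rw [show s / 2 * (Real.exp (s * 0) / s) = 2⁻¹ by simp; field_simp,
    ENNReal.ofReal_inv_of_pos two_pos, ENNReal.ofReal_ofNat]

/-- A Laplace variable with mean `0` is a fair coin, for every scale. -/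
theorem lintegral_lapMeasure_sign {s : ℝ} (hs : 0 < s) {f : ℝ → ℝ≥0∞} {a b : ℝ≥0∞}
    (ha : ∀ x, 0 < x → f x = a) (hb : ∀ x, x ≤ 0 → f x = b) :
    ∫⁻ x, f x ∂(lapMeasure s 0) = 2⁻¹ * a + 2⁻¹ * b := by
  rw [← lintegral_add_compl f (measurableSet_Ioi (a := (0 : ℝ))), Set.compl_Ioi,
    setLIntegral_congr_fun measurableSet_Ioi (g := fun _ => a) fun x hx => ha x hx,
    setLIntegral_congr_fun measurableSet_Iic (g := fun _ => b) fun x hx => hb x hx,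
    setLIntegral_const, setLIntegral_const, lapMeasure_Ioi hs, lapMeasure_Iic hs, mul_comm a,
    mul_comm b]

/-! ### The programs of the reduction -/

/-- Sampling the integer variable `z` from the discrete Laplace distribution with mean `0`. -/
def sampleInt (S : Sig) (z : ℕ) : Cmd S := .dlap z ⟨1, one_pos⟩ (.const S.zero)

/-- Putting the number `n` into the integer variable `0`. The old value is read because every
integer expression contains a variable. -/
def loadInput (S : Sig) (n : ℕ) : Cmd S := .assignZ 0 (.addConst (.smul 0 (.var 0)) n)

/-- The program with input variable `0` and output variable `1` that executes `pre`, puts `n` into the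
integer variable `0`, executes `post` and exits. -/
def inputProgram (pre post : List (Stmt S)) (n : ℕ) : Program S where
  inputs := [0]
  outputs := [1]
  body := Block.ofList (pre ++ .cmd (loadInput S n) :: post) .exit
  inputs_nodup := List.nodup_singleton _
  outputs_nodup := List.nodup_singleton _

/-- The probability that the output is in `A`, if the output is the input `x` when the
discrete Laplace guess `g` satisfies `r g ≠ 0` or when `c` is true, and `0` otherwise. -/
noncomputable def revealProb (ε : ℝ) (r : ℕ → ℕ) (c : Bool) (x : S.Dom) (A : Set S.Dom) : ℝ≥0∞ :=
  ∫⁻ g, A.indicator 1 (if r g.toNat ≠ 0 ∨ c = true then x else S.zero) ∂(dlapMeasure ε 0)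

/-- The assignments before the input number is loaded: a fair coin is stored in the Boolean variable
`1`, and the integer variables below `N` receive values, so that they may be read later. -/
def coinAndInit (S : Sig) (N : ℕ) : List (Cmd S) :=
  .lap 0 ⟨1, one_pos⟩ (.const S.zero) :: .cmpRE 1 .gt (.var 0) (.const S.zero) ::
    (List.range N).map (sampleInt S)

/-- Replacing a negative value of the integer variable `1` by `0`. -/
def clampGuess (S : Sig) : List (Stmt S) :=
  [.cmd (.cmpZE 0 .lt (.var 1) (.const S.zero)),
    .ite (.var 0) (.one (.cmd (.assignZ 1 (.smul 0 (.var 1))))) (.one (.cmd (.assignZ 1 (.var 1))))]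

/-- The input is revealed if the integer variable `2` is positive, or if `coin` is set and the Boolean
variable `1` is true. -/
def reveal (S : Sig) (coin : Bool) : List (Stmt S) :=
  [.cmd (.cmpZE 0 .gt (.var 2) (.const S.zero)),
    .ite (.or (.var 0) (.and (if coin = true then .tt else .ff) (.var 1)))
      (.one (.cmd (.assignD 1 (.var 0)))) (.one (.cmd (.assignD 1 (.const S.zero))))]

theorem exitTotal_sampleInt (ε : ℝ) {T : Set (Mem S)} (hT : MeasurableSet T) (z : ℕ)
    (k : List (Stmt S)) (m : Mem S) :
    exitTotal ε T (.cmd (sampleInt S z) :: k, m) =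
      ∫⁻ g, exitTotal ε T (k, m.setZ z g) ∂(dlapMeasure ε 0) := by
  rw [sampleInt, exitTotal_dlap ε hT]
  simp [DExpr.eval, Sig.zero]

theorem exitTotal_sampleInts {ε : ℝ} (hε : 0 < ε) {T : Set (Mem S)} (hT : MeasurableSet T)
    (k : List (Stmt S)) (c : ℝ≥0∞) (l : List ℕ) : ∀ (m : Mem S),
    (∀ m' : Mem S, m'.1 = m.1 → m'.2.1 = m.2.1 → exitTotal ε T (k, m') = c) →
    exitTotal ε T ((l.map (sampleInt S)).map .cmd ++ k, m) = c := by
  induction l with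
  | nil => exact fun m h => h m rfl rfl
  | cons i l ih =>
    intro m h
    rw [List.map_cons, List.map_cons, List.cons_append, exitTotal_sampleInt ε hT,
      lintegral_congr fun j => ih (m.setZ i j) fun m' h₁ h₂ => h m' h₁ h₂, lintegral_const,
      dlapMeasure_univ hε, mul_one]

theorem leads_clampGuess (k : List (Stmt S)) (m : Mem S) :
    ∃ m', Leads (clampGuess S ++ k, m) (k, m') ∧ m'.2.2.1 1 = (m.2.2.1 1).toNat ∧
      Preserves (fun j => j ≠ 1) m m' := by
  by_cases h : m.2.2.1 1 < 0
  · refine ⟨(m.setB 0 true).setZ 1 0, Leads.cmd (m' := m.setB 0 true) (fun ε => ?_)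
      (Leads.ite ?_), ?_, Preserves.setB.trans (.setZ (by simp))⟩
    · simp [Cmd.sem, ZExpr.eval, DExpr.eval, Sig.zero, Cmp.rel, h]
    · rw [if_pos (by simp [BExpr.eval])]
      exact Leads.cmd (m' := (m.setB 0 true).setZ 1 0)
        (fun ε => by simp [Cmd.sem, ZExpr.eval]) .refl
    · simp; omega
  · refine ⟨(m.setB 0 false).setZ 1 (m.2.2.1 1), Leads.cmd (m' := m.setB 0 false) (fun ε => ?_)
      (Leads.ite ?_), ?_, Preserves.setB.trans (.setZ (by simp))⟩
    · simp [Cmd.sem, ZExpr.eval, DExpr.eval, Sig.zero, Cmp.rel, h]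
    · rw [if_neg (by simp [BExpr.eval])]
      exact Leads.cmd (fun ε => rfl) .refl
    · simp; omega

theorem leads_reveal (coin : Bool) (k : List (Stmt S)) (m : Mem S) (a : ℕ) (ha : m.2.2.1 2 = a) :
    ∃ m', Leads (reveal S coin ++ k, m) (k, m') ∧
      m'.2.1 1 = if a ≠ 0 ∨ (coin && m.1 1) = true then m.2.1 0 else S.zero := by
  have hcond : (BExpr.or (.var 0) (.and (if coin = true then .tt else .ff) (.var 1)) :
      BExpr S).eval (m.setB 0 (decide (0 < a))) = true ↔ a ≠ 0 ∨ (coin && m.1 1) = true := by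
    cases coin <;> simp [BExpr.eval, Nat.pos_iff_ne_zero]
  refine ⟨(m.setB 0 (decide (0 < a))).setD 1 (if a ≠ 0 ∨ (coin && m.1 1) = true
    then m.2.1 0 else S.zero), Leads.cmd (m' := m.setB 0 (decide (0 < a))) (fun ε => ?_)
      (Leads.ite ?_), by simp [Mem.setD]⟩
  · simp [Cmd.sem, ZExpr.eval, DExpr.eval, Sig.zero, Cmp.rel, ha]
  · by_cases h : a ≠ 0 ∨ (coin && m.1 1) = true
    · rw [if_pos (hcond.2 h), if_pos h]
      exact Leads.cmd (fun ε => rfl) .refl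
    · rw [if_neg (mt hcond.1 h), if_neg h]
      exact Leads.cmd (fun ε => rfl) .refl

/-- `L` computes `r` from the integer variables `0` and `1` into the integer variable `2`. -/
def ComputesPair (L : List (Stmt S)) (r : ℕ → ℕ → ℕ) : Prop :=
  ∀ (k : List (Stmt S)) (m : Mem S) (n g : ℕ), m.2.2.1 0 = n → m.2.2.1 1 = g →
    ∃ m', Leads (L ++ k, m) (k, m') ∧ m'.2.2.1 2 = r n g ∧
      Preserves (fun j => j < 3 ∧ j ≠ 2) m m'

/-- The part of the program that follows the loading of the input number. -/
def guessAndReveal (L : List (Stmt S)) (coin : Bool) : List (Stmt S) :=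
  .cmd (sampleInt S 1) :: (clampGuess S ++ (L ++ reveal S coin))

theorem exitTotal_guessAndReveal {r : ℕ → ℕ → ℕ} {L : List (Stmt S)} (hL : ComputesPair L r)
    (coin : Bool) (ε : ℝ) (A : Set S.Dom) (m : Mem S) (n : ℕ)
    (hT : MeasurableSet {m : Mem S | m.2.1 1 ∈ A}) :
    exitTotal ε {m | m.2.1 1 ∈ A}
        (.cmd (loadInput S n) :: (guessAndReveal L coin ++ [.exit]), m) =
      revealProb ε (r n) (coin && m.1 1) (m.2.1 0) A := by
  have h₁ : Leads (.cmd (loadInput S n) :: (guessAndReveal L coin ++ [.exit]), m)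
      (guessAndReveal L coin ++ [.exit], m.setZ 0 n) :=
    Leads.cmd (m' := m.setZ 0 n) (fun ε => by simp [loadInput, Cmd.sem, ZExpr.eval]) .refl
  rw [h₁.exitTotal_eq ε hT, guessAndReveal, List.cons_append, exitTotal_sampleInt ε hT, revealProb]
  refine lintegral_congr fun g => ?_
  obtain ⟨m₁, hm₁, hg₁, hp₁⟩ := leads_clampGuess (L ++ (reveal S coin ++ [.exit]))
    ((m.setZ 0 n).setZ 1 g)
  obtain ⟨m₂, hm₂, hr₂, hp₂⟩ := hL (reveal S coin ++ [.exit]) m₁ n g.toNat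
    ((hp₁.1 0 (by simp)).trans (by simp)) (by simpa using hg₁)
  obtain ⟨m₃, hm₃, hd₃⟩ := leads_reveal coin [.exit] m₂ _ hr₂
  have hb : m₂.1 1 = m.1 1 := (hp₂.2.1 1 (by simp)).trans (hp₁.2.1 1 (by simp))
  have hd : m₂.2.1 = m.2.1 := hp₂.2.2.trans hp₁.2.2
  rw [hb, hd] at hd₃
  have hm : Leads ((clampGuess S ++ (L ++ reveal S coin)) ++ [.exit], (m.setZ 0 n).setZ 1 g)
      ([.exit], m₃) := by
    rw [List.append_assoc, List.append_assoc]
    exact hm₁.trans (hm₂.trans hm₃)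
  rw [hm.exitTotal_eq ε hT, exitTotal_exit, ← hd₃]
  rfl

theorem measurableSet_dom_mem (x : ℕ) (A : Set S.Dom) : MeasurableSet {m : Mem S | m.2.1 x ∈ A} :=
  (measurable_pi_apply x).comp (measurable_fst.comp measurable_snd) A.toFinite.measurableSet

/-- The fair coin splits the output probability into two halves; the values sampled by `coinAndInit` for the
integer variables do not matter, because they are overwritten before they influence the output. -/
theorem inputProgram_prob {r : ℕ → ℕ → ℕ} {L : List (Stmt S)} (hL : ComputesPair L r)
    (coin : Bool) (N n : ℕ) {ε : ℝ} (hε : 0 < ε) :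
    let P := inputProgram ((coinAndInit S N).map .cmd) (guessAndReveal L coin) n
    ∀ (u : P.Input) (O : Set P.Output), P.prob ε u O =
      2⁻¹ * revealProb ε (r n) coin (u ⟨0, Nat.one_pos⟩) {d | (fun _ => d) ∈ O} +
      2⁻¹ * revealProb ε (r n) false (u ⟨0, Nat.one_pos⟩) {d | (fun _ => d) ∈ O} := by
  intro P u O
  set A : Set S.Dom := {d | (fun _ => d) ∈ O}
  set x := u ⟨0, Nat.one_pos⟩ with hx
  have hA : {m | P.output m ∈ O} = {m : Mem S | m.2.1 1 ∈ A} := by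
    ext m
    have : P.output m = fun _ => m.2.1 1 := by
      funext ⟨i, hi⟩
      obtain rfl : i = 0 := Nat.lt_one_iff.1 hi
      rfl
    simp only [Set.mem_ofPred_eq, this, A]
  have hT := measurableSet_dom_mem 1 A
  have hbody : P.body.toList = (coinAndInit S N).map .cmd ++
      .cmd (loadInput S n) :: (guessAndReveal L coin ++ [.exit]) := by
    simp [P, inputProgram]
  have hinit : (P.initMem u).2.1 0 = x := by
    simp [Program.initMem, P, inputProgram, hx]
  have hcoin : ∀ y : ℝ, exitTotal ε {m : Mem S | m.2.1 1 ∈ A}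
      (.cmd (.cmpRE 1 .gt (.var 0) (.const S.zero)) ::
        (((List.range N).map (sampleInt S)).map .cmd ++
          .cmd (loadInput S n) :: (guessAndReveal L coin ++ [.exit])),
        (P.initMem u).setR 0 y) = revealProb ε (r n) (coin && decide (0 < y)) x A := by
    intro y
    have h₁ : ∀ k, Leads (.cmd (.cmpRE 1 .gt (.var 0) (.const S.zero)) :: k,
        (P.initMem u).setR 0 y) (k, ((P.initMem u).setR 0 y).setB 1 (decide (0 < y))) := fun k =>
      Leads.cmd (fun ε => by
        simp [Cmd.sem, RExpr.eval, DExpr.eval, Sig.zero, Cmp.rel, Mem.setR]) .refl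
    rw [(h₁ _).exitTotal_eq ε hT]
    refine exitTotal_sampleInts hε hT _ _ _ _ fun m' hb hd => ?_
    rw [exitTotal_guessAndReveal hL coin ε A m' n hT, hb, hd]
    simp [Mem.setR, hinit]
  have hprob : P.prob ε u O = exitTotal ε {m | P.output m ∈ O} (P.body.toList, P.initMem u) := rfl
  rw [hprob, hA, hbody, coinAndInit, List.map_cons, List.map_cons, List.cons_append,
    List.cons_append, exitTotal_lap ε hT]
  simp only [DExpr.eval, Rat.cast_one, one_mul]
  rw [show (((S.zero : S.Dom) : ℤ) : ℝ) = 0 from Int.cast_zero]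
  refine lintegral_lapMeasure_sign hε (fun y hy => ?_) (fun y hy => ?_)
  · rw [hcoin, decide_eq_true hy, Bool.and_true]
  · rw [hcoin, decide_eq_false hy.not_gt, Bool.and_false]

theorem inputProgram_assignedBeforeUse {L : List (Stmt S)} {N : ℕ}
    (hL : ∀ s ∈ L, s.allReads ⊆ workVars N) (coin : Bool) (n : ℕ) :
    (inputProgram ((coinAndInit S (N + 3)).map .cmd)
      (guessAndReveal L coin) n).AssignedBeforeUse := by
  have hinit : ∀ (A : Set Var) (l : List ℕ), ReadsAssigned A (l.map (sampleInt S)) := by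
    intro A l
    induction l generalizing A with
    | nil => trivial
    | cons i l ih => exact ⟨Set.empty_subset _, ih _⟩
  -- The registers `0`, `1` and `2` are read outside `L`, even if `N` is smaller than `3`.
  have hint : ∀ i < N + 3, Var.int i ∈ {v | v ∈ (coinAndInit S (N + 3)).map Cmd.target} :=
    fun i hi => by
      simp only [coinAndInit, List.map_cons, List.map_map, Set.mem_ofPred_eq, List.mem_cons,
        List.mem_map, List.mem_range]
      exact .inr (.inr ⟨i, hi, rfl⟩)
  have hbool : Var.bool 1 ∈ {v | v ∈ (coinAndInit S (N + 3)).map Cmd.target} := by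
    simp [coinAndInit, Cmd.target]
  refine Program.assignedBeforeUse_of_straightLine _
    (coinAndInit S (N + 3) ++ [loadInput S n, sampleInt S 1, .cmpZE 0 .lt (.var 1) (.const S.zero)])
    ((clampGuess S).tail ++ (L ++ reveal S coin ++ [.exit])) ?_ ?_ ?_
  · simp [inputProgram, guessAndReveal, clampGuess]
  · refine readsAssigned_append.2 ⟨⟨Set.empty_subset _, ?_, hinit _ _⟩, ?_, Set.empty_subset _, ?_,
      trivial⟩
    · simp [Cmd.reads, RExpr.vars, DExpr.vars, Cmd.target]
    · exact Set.singleton_subset_iff.2 (Or.inr (hint 0 (by omega)))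
    · simp [Cmd.reads, ZExpr.vars, DExpr.vars, Cmd.target, sampleInt]
  · set A := {v | ∃ x ∈ (inputProgram ((coinAndInit S (N + 3)).map .cmd)
      (guessAndReveal L coin) n).inputs, v = Var.dom x} ∪ {v | v ∈ (coinAndInit S (N + 3) ++
        [loadInput S n, sampleInt S 1, .cmpZE 0 .lt (.var 1) (.const S.zero)]).map Cmd.target}
    have hA : {v | v ∈ (coinAndInit S (N + 3)).map Cmd.target} ⊆ A := fun v hv =>
      .inr (by simp only [List.map_append, Set.mem_ofPred_eq, List.mem_append]; exact .inl hv)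
    have hA₀ : Var.bool 0 ∈ A := .inr (by simp [Cmd.target])
    have hdom : Var.dom 0 ∈ A := .inl ⟨0, List.mem_cons_self, rfl⟩
    have hwork : workVars N ⊆ A := by
      rintro v (rfl | ⟨j, hj, rfl⟩)
      · exact hA₀
      · exact hA (hint j (by omega))
    have h₁ := hA (hint 1 (by omega))
    have h₂ := hA (hint 2 (by omega))
    have hb := hA hbool
    intro s hs
    simp only [clampGuess, reveal, List.tail_cons, List.mem_append, List.mem_cons,
      List.not_mem_nil, or_false] at hs
    rcases hs with rfl | (hs | rfl | rfl) | rfl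
    · simp [Stmt.allReads, Block.allReads, Cmd.reads, ZExpr.vars, BExpr.vars,
        Set.insert_subset_iff, hA₀, h₁]
    · exact (hL s hs).trans hwork
    · simp [Stmt.allReads, Cmd.reads, ZExpr.vars, DExpr.vars, h₂]
    · cases coin <;>
        simp [Stmt.allReads, Block.allReads, Cmd.reads, BExpr.vars, DExpr.vars,
          Set.insert_subset_iff, hA₀, hb, hdom]
    · simp [Stmt.allReads]

/-- For a primitive recursive `r` there are programs, parametrized by `n`, that sample a guess `g` and
reveal the input with output probabilities as in `revealProb`; if `coin` is set, they also reveal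
the input when a fair coin shows heads. -/
theorem exists_revealing_program (S : Sig) {r : ℕ → ℕ → ℕ} (hr : Primrec₂ r) (coin : Bool) :
    ∃ pre post : List (Stmt S), ∀ n,
      (inputProgram pre post n).AssignedBeforeUse ∧
      ∀ (ε : ℝ), 0 < ε → ∀ (u : (inputProgram pre post n).Input)
        (O : Set (inputProgram pre post n).Output), (inputProgram pre post n).prob ε u O =
          2⁻¹ * revealProb ε (r n) coin (u ⟨0, Nat.one_pos⟩) {d | (fun _ => d) ∈ O} +
          2⁻¹ * revealProb ε (r n) false (u ⟨0, Nat.one_pos⟩) {d | (fun _ => d) ∈ O} := by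
  obtain ⟨L, N, hLN, hL⟩ := compiles_of_primrec (S := S) (Nat.Primrec'.prim_iff₂.2 hr)
    (fun i => i) 2 3 (fun i => by omega) (by omega)
  have hL' : ComputesPair L r := fun k m n g hn hg => by
    simpa using hL k m (n ::ᵥ g ::ᵥ .nil) (Fin.forall_fin_two.2 ⟨hn, hg⟩)
  exact ⟨(coinAndInit S (N + 3)).map .cmd, guessAndReveal L coin, fun n =>
    ⟨inputProgram_assignedBeforeUse hLN coin n, fun ε hε => inputProgram_prob hL' coin _ n hε⟩⟩

/-! ### Privacy of the programs -/

theorem Sig.one_ne_zero (S : Sig) : S.one ≠ S.zero := by simp [Sig.one, Sig.zero]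

theorem revealProb_const {ε : ℝ} (hε : 0 < ε) {r : ℕ → ℕ} {c : Bool} {x y : S.Dom} {A : Set S.Dom}
    (h : ∀ g, (if r g ≠ 0 ∨ c = true then x else S.zero) = y) :
    revealProb ε r c x A = A.indicator 1 y := by
  simp only [revealProb, h, lintegral_const, dlapMeasure_univ hε, mul_one]

theorem revealProb_pos {ε : ℝ} (hε : 0 < ε) {r : ℕ → ℕ} {g : ℕ} (hg : r g ≠ 0) (c : Bool) :
    0 < revealProb ε r c S.one {S.one} := by
  rw [revealProb, lintegral_dlapMeasure]
  refine lt_of_lt_of_le ?_ (ENNReal.le_tsum (g : ℤ))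
  have hq₁ : Real.exp (-ε) < 1 := Real.exp_zero ▸ Real.exp_lt_exp.2 (by linarith)
  have : 0 < 1 - Real.exp (-ε) := by linarith
  simp only [Int.toNat_natCast, ne_eq, hg, not_false_eq_true, true_or, if_true,
    Set.indicator_of_mem (Set.mem_singleton S.one), Pi.one_apply, mul_one, ENNReal.ofReal_pos]
  positivity

theorem revealProb_univ {ε : ℝ} (hε : 0 < ε) (r : ℕ → ℕ) (c : Bool) (x : S.Dom) :
    revealProb ε r c x Set.univ = 1 := by
  simp [revealProb, dlapMeasure_univ hε]

/-- A program whose output probabilities are given by `revealProb` is private, with slack `1 / 2` if the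
fair coin is used and without slack otherwise, exactly if no guess reveals the input. -/
theorem dp_iff_of_prob {pre post : List (Stmt S)} {n : ℕ} {r : ℕ → ℕ} {coin : Bool} {ε : ℝ}
    (hε : 0 < ε)
    (h : ∀ (u : (inputProgram pre post n).Input) (O : Set (inputProgram pre post n).Output),
      (inputProgram pre post n).prob ε u O =
        2⁻¹ * revealProb ε r coin (u ⟨0, Nat.one_pos⟩) {d | (fun _ => d) ∈ O} +
        2⁻¹ * revealProb ε r false (u ⟨0, Nat.one_pos⟩) {d | (fun _ => d) ∈ O}) :
    (inputProgram pre post n).DP ε ε (if coin = true then 1 / 2 else 0)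
      (flipAdj (inputProgram pre post n)) ↔ ∀ g, r g = 0 := by
  have hhalf : ENNReal.ofReal (1 / 2) = 2⁻¹ := by
    rw [one_div, ENNReal.ofReal_inv_of_pos two_pos, ENNReal.ofReal_ofNat]
  constructor
  · intro hdp g
    by_contra hg
    have h₁ := hdp {fun _ => S.one} (fun _ => S.one) (fun _ => S.zero) (by simp [flipAdj])
    have hA : {d : S.Dom | (fun _ => d) ∈ ({fun _ => S.one} : Set (inputProgram pre post n).Output)}
        = {S.one} := by
      ext d
      simp only [Set.mem_ofPred_eq, Set.mem_singleton_iff]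
      exact ⟨fun h => congrFun h ⟨0, Nat.one_pos⟩, fun h => by rw [h]⟩
    have hz : ∀ c, revealProb ε r c S.zero {S.one} = 0 := fun c => by
      rw [revealProb_const hε (y := S.zero) fun g => by simp]
      simp [(Sig.one_ne_zero S).symm]
    rw [h, h, hA, hz, hz] at h₁
    have hpos := revealProb_pos (S := S) hε hg false
    cases coin with
    | false =>
      simp only [mul_zero, add_zero, Bool.false_eq_true, if_false, ENNReal.ofReal_zero,
        nonpos_iff_eq_zero, ← add_mul, ENNReal.inv_two_add_inv_two, one_mul] at h₁
      exact hpos.ne' h₁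
    | true =>
      rw [revealProb_const hε (c := true) (y := S.one) fun g => by simp] at h₁
      simp only [Set.indicator_of_mem (Set.mem_singleton S.one), Pi.one_apply, mul_one, mul_zero,
        add_zero, zero_add, if_true, hhalf] at h₁
      exact (ENNReal.lt_add_right (by simp) (by simp [hpos.ne'])).not_ge h₁
  · intro hr O u u' _
    have hz : ∀ (x : S.Dom) (A : Set S.Dom), revealProb ε r false x A = A.indicator 1 S.zero :=
      fun x A => revealProb_const hε fun g => by simp [hr]
    have hexp : (1 : ℝ≥0∞) ≤ ENNReal.ofReal (Real.exp ε) := by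
      rw [← ENNReal.ofReal_one]
      exact ENNReal.ofReal_le_ofReal (Real.one_le_exp hε.le)
    rw [h, h, hz, hz]
    cases coin with
    | false =>
      rw [hz, hz]
      exact le_add_right (le_mul_of_one_le_left' hexp)
    | true =>
      set a := revealProb ε r true (u ⟨0, Nat.one_pos⟩) {d | (fun _ => d) ∈ O} with ha
      set b := revealProb ε r true (u' ⟨0, Nat.one_pos⟩) {d | (fun _ => d) ∈ O}
      set z : ℝ≥0∞ := Set.indicator {d : S.Dom | (fun _ => d) ∈ O} 1 S.zero
      have ha₁ : a ≤ 1 := by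
        rw [ha, revealProb_const hε (y := u ⟨0, Nat.one_pos⟩) fun g => by simp]
        exact Set.indicator_le_self _ _ _
      calc 2⁻¹ * a + 2⁻¹ * z ≤ 2⁻¹ * 1 + (2⁻¹ * b + 2⁻¹ * z) := by
            gcongr
            exact le_add_self
        _ = 2⁻¹ * b + 2⁻¹ * z + 2⁻¹ := by rw [mul_one, add_comm]
        _ ≤ _ := by
            rw [if_pos rfl, hhalf]
            gcongr
            exact le_mul_of_one_le_left' hexp

/-- The reduction, without its computability: for each `coin` there are programs, parametrized by `n`,
that are private if and only if no guess is accepted for `n`. -/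
theorem exists_reduction (S : Sig) {r : ℕ → ℕ → ℕ} (hr : Primrec₂ r) (coin : Bool) :
    ∃ pre post : List (Stmt S), ∀ n, (inputProgram pre post n).Admissible ∧
      ∀ ε : ℝ, 0 < ε →
        ((inputProgram pre post n).DP ε ε (if coin = true then 1 / 2 else 0)
          (flipAdj (inputProgram pre post n)) ↔ ∀ g, r n g = 0) := by
  obtain ⟨pre, post, h⟩ := exists_revealing_program S hr coin
  refine ⟨pre, post, fun n => ⟨⟨fun ε hε u => ?_, (h n).1⟩,
    fun ε hε => dp_iff_of_prob hε ((h n).2 ε hε)⟩⟩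
  rw [(h n).2 ε hε]
  simp [revealProb_univ hε, ENNReal.inv_two_add_inv_two]

/-! ### Computability of the reduction -/

theorem primrec_encode_natCast : Primrec fun n : ℕ => Encodable.encode (n : ℤ) := by
  refine (Primrec.nat_mul.comp (.const 2) .id).of_eq fun n => ?_
  rfl

theorem primrec_code_inputProgram (pre post : List (Stmt S)) :
    Primrec fun n => (inputProgram pre post n).code := by
  have hpair : ∀ {f g : ℕ → ℕ}, Primrec f → Primrec g → Primrec fun n => Nat.pair (f n) (g n) :=
    fun hf hg => Primrec₂.natPair.comp hf hg
  refine hpair (.const _) (hpair (.const _) ?_)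
  change Primrec fun n => (Block.ofList (pre ++ .cmd (loadInput S n) :: post) .exit).code
  induction pre with
  | nil =>
    exact hpair (.const 1) (hpair (hpair (.const 0) (hpair (.const 1) (hpair (.const 0)
      (hpair (.const 4) (hpair (.const _) primrec_encode_natCast))))) (.const _))
  | cons s pre ih => exact hpair (.const 1) (hpair (.const _) ih)

/-- The result of running the program with code `n` on the input `0` with the time bound `g`, as a number: it is
nonzero exactly if the program halts within this bound. -/
def haltsWithin (n g : ℕ) : ℕ :=
  Encodable.encode (Nat.Partrec.Code.evaln g (Denumerable.ofNat Nat.Partrec.Code n) 0)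

theorem primrec_haltsWithin : Primrec₂ haltsWithin :=
  Primrec.encode.comp (Nat.Partrec.Code.primrec_evaln.comp
    (Primrec.pair (Primrec.pair .snd ((Primrec.ofNat _).comp .fst)) (.const 0)))

theorem haltsWithin_encode_eq_zero (c : Nat.Partrec.Code) :
    (∀ g, haltsWithin (Encodable.encode c) g = 0) ↔ ¬ (c.eval 0).Dom := by
  have hnone : ∀ o : Option ℕ, Encodable.encode o = 0 ↔ ∀ x, x ∉ o := by
    rintro (_ | x) <;> simp
  simp only [haltsWithin, Denumerable.ofNat_encode, hnone, Part.dom_iff_mem,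
    Nat.Partrec.Code.evaln_complete, not_exists]
  exact forall_comm

/-- A problem is undecidable if the complement of the halting problem can be reduced to it. -/
theorem not_decidableOn_of_reduction {α : Type} {code : α → ℕ} {D : Set α} {Q : α → Prop}
    (I : ℕ → α) (hI : Computable fun n => code (I n)) (hD : ∀ n, I n ∈ D)
    (hQ : ∀ n, Q (I n) ↔ ∀ g, haltsWithin n g = 0) : ¬ DecidableOn code D Q := by
  rintro ⟨f, hf, h⟩
  choose b hb hbQ using fun n => h (I n) (hD n)
  have hbc : Computable b := (hf.comp hI).of_eq_tot hb
  refine ComputablePred.halting_problem 0 (ComputablePred.computable_iff.2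
    ⟨fun c => !(b (Encodable.encode c)), Primrec.not.to_comp.comp (hbc.comp Computable.encode), ?_⟩)
  funext c
  have h₁ := (hbQ (Encodable.encode c)).trans ((hQ _).trans (haltsWithin_encode_eq_zero c))
  rw [Bool.not_eq_true', ← Bool.not_eq_true, h₁, not_not]

theorem codeAdj_flipAdj (pre post : List (Stmt S)) (n : ℕ) :
    codeAdj (flipAdj (inputProgram pre post n)) =
      Encodable.encode [([(0 : ℤ)], [(1 : ℤ)]), ([1], [0])] := by
  unfold codeAdj
  congr 1

theorem symmetricList_flipAdj (P : Program S) : SymmetricList (flipAdj P) := by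
  intro u u' h
  simp only [flipAdj, List.mem_cons, Prod.mk.injEq, List.not_mem_nil, or_false] at h ⊢
  tauto

end SimpleDP

open SimpleDP in
theorem theorem1 (S : SimpleDP.Sig) (Θ : SimpleDP.ErrorNames) :
    ¬ DecidableOn (FixedInstance.code (S := S)) {I | I.Valid} (fun I => I.Private) ∧
    ¬ DecidableOn (UniformInstance.code (S := S) (Θ := Θ)) {I | I.Valid} (fun I => I.Private) ∧
    (∀ ε₀ : ℚ, 0 < ε₀ →
      ¬ DecidableOn (Program.code (S := S)) (oneInOneOut S)
        (fun P => P.DP (ε₀ : ℝ) (ε₀ : ℝ) 0 (flipAdj P))) ∧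
    ¬ DecidableOn (Program.code (S := S)) (oneInOneOut S)
        (fun P => ∀ ε : ℝ, 0 < ε → P.DP ε ε 0 (flipAdj P)) := by
  -- The programs without the coin serve `δ = 0`, those with the coin serve `δ₀ = 1 / 2`.
  obtain ⟨pre, post, h⟩ := exists_reduction S primrec_haltsWithin false
  obtain ⟨pre', post', h'⟩ := exists_reduction S primrec_haltsWithin true
  have hall : ∀ n, (∀ ε : ℝ, 0 < ε → (inputProgram pre post n).DP ε ε 0
      (flipAdj (inputProgram pre post n))) ↔ ∀ g, haltsWithin n g = 0 := fun n =>
    ⟨fun hdp => ((h n).2 1 one_pos).1 (hdp 1 one_pos), fun hg ε hε => ((h n).2 ε hε).2 hg⟩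
  have hpair : ∀ {f g : ℕ → ℕ}, Primrec f → Primrec g → Primrec fun n => Nat.pair (f n) (g n) :=
    fun hf hg => Primrec₂.natPair.comp hf hg
  refine ⟨?_, ?_, fun ε₀ hε₀ => ?_, ?_⟩
  · refine not_decidableOn_of_reduction
      (fun n => ⟨inputProgram pre' post' n, flipAdj _, 1, 1 / 2, 1⟩) ?_ (fun n => ?_) fun n => ?_
    · simp only [FixedInstance.code, codeAdj_flipAdj]
      exact (hpair (primrec_code_inputProgram pre' post') (.const _)).to_comp
    · exact ⟨(h' n).1, symmetricList_flipAdj _, by norm_num, by norm_num, by norm_num⟩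
    · simpa [FixedInstance.Private] using (h' n).2 1 one_pos
  · refine not_decidableOn_of_reduction
      (fun n => ⟨inputProgram pre post n, ⟨0, none, false, false⟩, .const 0, flipAdj _, 1⟩)
      ?_ (fun n => ?_) fun n => ?_
    · simp only [UniformInstance.code, codeAdj_flipAdj]
      exact (hpair (primrec_code_inputProgram pre post) (.const _)).to_comp
    · refine ⟨(h n).1, ?_, ?_, symmetricList_flipAdj _, one_pos⟩
      · intro x hx
        simpa [RatInterval.toSet] using hx
      · simp [ErrorFn.val]
    · rw [← hall]
      simp [UniformInstance.Private, RatInterval.toSet, ErrorFn.val]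
  · refine not_decidableOn_of_reduction (inputProgram pre post)
      (primrec_code_inputProgram pre post).to_comp (fun n => ⟨(h n).1, rfl, rfl⟩) fun n => ?_
    exact (h n).2 ε₀ (Rat.cast_pos.2 hε₀)
  · exact not_decidableOn_of_reduction (inputProgram pre post)
      (primrec_code_inputProgram pre post).to_comp (fun n => ⟨(h n).1, rfl, rfl⟩) hall
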